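/- Let $n\ge 1$, let $D\subset\mathbb R^n$ be a bounded domain with smooth boundary, and let $A$ be a finite-dimensional associative unital real algebra with unit $e_0$. Let $a^j_m:\overline D\to A$ ($1\le j\le n$, $1\le m\le q$) be of class $C^1$. Let $\varphi_m(x,y)$ ($1\le m\le q$) be $A$-valued functions such that, for the point $x\in D$ under consideration, $\varphi_m(x,x)=0$ and $\varphi_m(x,\cdot)$ is $C^1$ on $\overline D$. Put $b^j_m(x)=\frac{\partial\varphi_m}{\partial y_j}(x,x)$, $\widetilde\varphi_m(x,y)=\sum_i b^i_m(x)(y_i-x_i)$ and $\Phi_m=\varphi_m-\widetilde\varphi_m$. Let $N:\mathbb R^n\to[0,\infty)$ satisfy $N(\lambda y)=|\lambda|N(y)$ for $\lambda\in\mathbb R$, $N(y)=0$ only for $y=0$, and $N\in C^1(\mathbb R^n\setminus\{0\})$; let $\mathrm{Vol}_N$ be the volume of $\{N<1\}$, and let $\mathrm{Vol}$ be the volume of the Euclidean unit ball. Condition (C2) for $N$ at $x$: $$\sum_{m,j}a^j_m(x)\frac{\partial\varphi_m}{\partial y_j}(x,x)=\frac{e_0}{\mathrm{Vol}_N},\qquad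 \sum_{m,j}a^j_m(y)\Big[\frac{\partial\varphi_m}{\partial y_j}(x,y)-\frac{\partial\log N(y-x)^n}{\partial y_j}\varphi_m(x,y)\Big]=0\quad(y\in D\setminus\{x\}).$$ Condition (C5) at $x$: $$\sum_m a^j_m(x)b^j_m(x)=\frac{e_0}{n\mathrm{Vol}}\ \ (1\le j\le n),\qquad \sum_m\big(a^j_m(x)b^i_m(x)+a^i_m(x)b^j_m(x)\big)=0\ \ (i\ne j).$$ Remainder equation (R) at $x$ (Euclidean norm): for all $y\in D\setminus\{x\}$, $$\sum_{m,j}a^j_m(y)\Big[\frac{\partial\Phi_m}{\partial y_j}-\frac{n}{2\|y-x\|^2}\frac{\partial\|y-x\|^2}{\partial y_j}\Phi_m\Big]=-\sum_{m,j}\big(a^j_m(y)-a^j_m(x)\big)\Big[b^j_m(x)-\frac{n}{2\|y-x\|^2}\frac{\partial\|y-x\|^2}{\partial y_j}\widetilde\varphi_m(x,y)\Big].$$ (1) Let $f:\overline D\to A$ be $C^1$ with $\sum_j\frac{\partial}{\partial y_j}(f a^j_m)=0$ in $D$ for all $m$. If (C2) holds for $N$ at $x\in D$, then $$f(x)=\int_{\partial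 D}f(y)\sum_m\Big[\Big(\sum_j a^j_m(y)\frac{\partial}{\partial y_j}\Big)\lrcorner\Big(\frac{\varphi_m(x,y)}{N(y-x)^n}\,dy_1\wedge\dots\wedge dy_n\Big)\Big].$$ (2) If $N$ is the Euclidean norm, then (C2) at $x$ is equivalent to (C5) and (R) at $x$; in particular, for $f$ as in (1), the formula holds with $N=\|\cdot\|$ if (C5) and (R) hold at $x$. (3) Let $A$ be commutative, let $N$ be the Euclidean norm, let $1\le q\le n$, let $x\in D$, and suppose that some $q\times q$ determinant $D_0$ formed by $q$ rows of the $n\times q$ matrix $(a^j_m(x))_{j,m}$ is invertible; number the rows (and the coordinates) such that these are the rows $1,\dots,q$. Let $D^k_m$ be the determinant obtained from $D_0$ by deleting the row $m$ and adding the row $q+k$ at the bottom, and consider the conditions $$(A)\qquad\sum_{m=1}^q D^l_mD^k_m+\delta^l_k D_0^2=0\qquad(1\le k,l\le n-q).$$ If (C2) holds at $x$, or if (C5) at $x$ has any solution $b=(b^j_m)$ in $A$, then (A) holds. Moreover every such $b$ (in the case of (C2): $b^i_m=\frac{\partial\varphi_m}{\partial y_i}(x,x)$) is of the form $$b^i_m=\frac{1}{\mathrm{Vol}}\sum_{l=1}^q(-1)^{m+l}c^l_i\,D_0^{-1}\widehat{D^l_m}=\frac{1}{\mathrm{Vol}}D_0^{-1}\widetilde{D^i_m},$$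 where $\widehat{D^l_m}$ is the minor of $D_0$ with the row $l$ and the column $m$ deleted, $\widetilde{D^i_m}$ is obtained from $D_0$ by replacing the column $m$ by $(c^1_i,\dots,c^q_i)$, and where the $c^l_i\in A$ ($1\le l\le q$, $1\le i\le n$) satisfy $c^l_l=\frac{e_0}{n}$, $c^l_i=-c^i_l$ for $i\neq l$, $i\le q$, and $c^l_{q+k}=-D_0^{-1}\sum_{m=1}^q(-1)^{q+m}D^k_mc^m_l$ for $1\le k\le n-q$. Conversely, if (A) holds, then every choice of such $c^l_i$ gives by these formulas a solution $b$ of (C5) at $x$. -/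

import Mathlib

open scoped ContDiff

noncomputable section

namespace CauchyAlgebra

/-- The Euclidean space `ℝⁿ` of dimension `n = d + 1 ≥ 1`. -/
abbrev Space (d : ℕ) : Type := EuclideanSpace ℝ (Fin (d + 1))

/-- The partial derivative `∂g/∂y_j` at `y`. -/
def partialDeriv {d : ℕ} {F : Type*} [NormedAddCommGroup F] [NormedSpace ℝ F]
    (g : Space d → F) (j : Fin (d + 1)) (y : Space d) : F :=
  fderiv ℝ g y (EuclideanSpace.single j 1)

/-! ### Bounded domains with smooth boundary and integrals over the boundary -/

/-- An open set `U` in which `D` is the side `s (y_k - γ(y')) < 0` of the graph `y_k = γ(y')` of a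
smooth function `γ` of the other coordinates `y'`, with `s = 1` or `s = -1`. -/
structure BoundaryPatch {d : ℕ} (D : Set (Space d)) where
  U : Set (Space d)
  isOpen_U : IsOpen U
  k : Fin (d + 1)
  s : ℝ
  s_eq : s = 1 ∨ s = -1
  γ : (Fin d → ℝ) → ℝ
  γ_smooth : ContDiff ℝ ∞ γ
  inter_eq : D ∩ U = {y | y ∈ U ∧ s * (y k - γ fun i => y (k.succAbove i)) < 0}

/-- The parametrization `y' ↦ (y', γ(y'))` of the graph (the entry `γ(y')` at position `k`). -/
def BoundaryPatch.param {d : ℕ} {D : Set (Space d)} (P : BoundaryPatch D) (t : Fin d → ℝ) :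
    Space d :=
  WithLp.toLp 2 (P.k.insertNth (α := fun _ => ℝ) (P.γ t) t)

/-- The normal `s (e_k - ∑ ∂_i γ e_i)`, that is, the gradient of `s (y_k - γ(y'))`, which points out
of `D`. Its length is the area density `√(1 + |∇γ|²)` of the graph, so that
`P.normal t dt = ν dσ`, with `ν` the outward unit normal and `dσ` the surface element. -/
def BoundaryPatch.normal {d : ℕ} {D : Set (Space d)} (P : BoundaryPatch D) (t : Fin d → ℝ) :
    Fin (d + 1) → ℝ :=
  P.k.insertNth (α := fun _ => ℝ) P.s fun i => -P.s * fderiv ℝ P.γ t (Pi.single i 1)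

/-- A bounded domain (nonempty connected open set) of `ℝⁿ` with smooth boundary: near each of its
boundary points it is one side of the graph of a smooth function. -/
structure IsSmoothBoundedDomain {d : ℕ} (D : Set (Space d)) : Prop where
  isOpen : IsOpen D
  isConnected : IsConnected D
  isBounded : Bornology.IsBounded D
  smooth : ∀ p ∈ frontier D, ∃ P : BoundaryPatch D, p ∈ P.U

/-- Finitely many boundary patches of `D` with a subordinate smooth partition of unity on `∂D`. -/
structure BoundaryAtlas {d : ℕ} (D : Set (Space d)) where
  card : ℕ
  patch : Fin card → BoundaryPatch D
  χ : Fin card → Space d → ℝ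
  χ_smooth : ∀ i, ContDiff ℝ ∞ (χ i)
  χ_nonneg : ∀ i y, 0 ≤ χ i y
  χ_support : ∀ i, tsupport (χ i) ⊆ (patch i).U
  χ_sum : ∀ y ∈ frontier D, ∑ i, χ i y = 1

section Integral

variable {d : ℕ} {A : Type*} [NormedAddCommGroup A] [NormedSpace ℝ A]

/-- The integral over `∂D`, with its orientation as the boundary of `D`, of the `A`-valued
`(n-1)`-form `∑_j (-1)^(j-1) g_j dy_1 ∧ … ∧ (dy_j omitted) ∧ … ∧ dy_n`
(which restricts to `∑_j g_j ν_j dσ` on `∂D`), computed in the patches of an atlas. -/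
def BoundaryAtlas.integral {D : Set (Space d)} (T : BoundaryAtlas D)
    (g : Fin (d + 1) → Space d → A) : A :=
  ∑ i, ∫ t : Fin d → ℝ, T.χ i ((T.patch i).param t) •
    ∑ j, (T.patch i).normal t j • g j ((T.patch i).param t)

/-- The integral over the oriented boundary `∂D` of the form
`∑_j (-1)^(j-1) g_j dy_1 ∧ … ∧ (dy_j omitted) ∧ … ∧ dy_n` is `I`: there are atlases, and each of
them gives the value `I`. -/
def HasBoundaryIntegral (D : Set (Space d)) (g : Fin (d + 1) → Space d → A) (I : A) : Prop :=
  Nonempty (BoundaryAtlas D) ∧ ∀ T : BoundaryAtlas D, T.integral g = I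

end Integral

/-! ### The conditions on the kernel functions -/

/-- A function `N = |||·|||` on `ℝⁿ` which is nonnegative, absolutely homogeneous, zero only at the
origin, and `C¹` off the origin (no triangle inequality). -/
structure IsSmoothGauge {d : ℕ} (N : Space d → ℝ) : Prop where
  nonneg : ∀ y, 0 ≤ N y
  homogeneous : ∀ (c : ℝ) (y), N (c • y) = |c| * N y
  eq_zero : ∀ y, N y = 0 → y = 0
  contDiffOn : ContDiffOn ℝ 1 N {0}ᶜ

/-- `Vol(B(0,1))`, the volume of the unit ball `{y : N y < 1}` of `N`. -/
def ballVol {d : ℕ} (N : Space d → ℝ) : ℝ :=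
  (MeasureTheory.volume {y : Space d | N y < 1}).toReal

/-- The Euclidean norm of `ℝⁿ`. -/
def euclideanNorm (d : ℕ) : Space d → ℝ := fun y => ‖y‖

section Conditions

variable {d q : ℕ} {A : Type*} [NormedRing A] [NormedAlgebra ℝ A]

/-- The conditions `∑_j ∂(f a^j_m)/∂y_j = 0` on `D`, for all `m`. The coefficient `a^j_m` is
`a j m`. -/
def CauchyConditions (D : Set (Space d)) (a : Fin (d + 1) → Fin q → Space d → A)
    (f : Space d → A) : Prop :=
  ∀ m, ∀ y ∈ D, ∑ j, partialDeriv (fun z => f z * a j m z) j y = 0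

/-- The functions `φ_m(x, ·)` are `C¹` on the closure of `D` and `φ_m(x, x) = 0`. -/
def IsKernelFamily (D : Set (Space d)) (φ : Fin q → Space d → Space d → A) (x : Space d) : Prop :=
  ∀ m, ContDiffOn ℝ 1 (φ m x) (closure D) ∧ φ m x x = 0

/-- `b^j_m(x) = ∂φ_m/∂y_j (x, x)`, the coefficients of the first order part of `φ_m(x, ·)` at `x`,
as a matrix with entry `b^j_m` at `(j, m)`. -/
def linCoeff (φ : Fin q → Space d → Space d → A) (x : Space d) :
    Matrix (Fin (d + 1)) (Fin q) A :=
  fun j m => partialDeriv (φ m x) j x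

/-- The conditions (C2) at the point `x`. -/
def CondC2 (N : Space d → ℝ) (D : Set (Space d)) (a : Fin (d + 1) → Fin q → Space d → A)
    (φ : Fin q → Space d → Space d → A) (x : Space d) : Prop :=
  (∑ m, ∑ j, a j m x * partialDeriv (φ m x) j x = (ballVol N)⁻¹ • (1 : A)) ∧
  ∀ y ∈ D, y ≠ x →
    ∑ m, ∑ j, a j m y * (partialDeriv (φ m x) j y
      - partialDeriv (fun z => Real.log (N (z - x) ^ (d + 1))) j y • φ m x y) = 0

/-- The conditions (C5) for two `n × q` matrices `α = (a^j_m)` and `b = (b^j_m)`. -/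
def CondC5 (α b : Matrix (Fin (d + 1)) (Fin q) A) : Prop :=
  (∀ j, ∑ m, α j m * b j m = ((d + 1 : ℝ) * ballVol (euclideanNorm d))⁻¹ • (1 : A)) ∧
  ∀ i j, i ≠ j → ∑ m, (α j m * b i m + α i m * b j m) = 0

/-- The first order part `∑_i b^i_m(x) (y_i - x_i)` of `φ_m(x, y)`. -/
def linPart (φ : Fin q → Space d → Space d → A) (m : Fin q) (x y : Space d) : A :=
  ∑ i, (y i - x i) • linCoeff φ x i m

/-- The remainder `Φ_m(x, y) = φ_m(x, y) - ∑_i b^i_m(x) (y_i - x_i)`. -/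
def remPart (φ : Fin q → Space d → Space d → A) (m : Fin q) (x y : Space d) : A :=
  φ m x y - linPart φ m x y

/-- The equation for the remainders `Φ_m(x, ·)` in the Euclidean case (the terms of order at least
one in `y - x` of the second condition of (C2)). -/
def RemainderEquation (D : Set (Space d)) (a : Fin (d + 1) → Fin q → Space d → A)
    (φ : Fin q → Space d → Space d → A) (x : Space d) : Prop :=
  ∀ y ∈ D, y ≠ x →
    ∑ m, ∑ j, a j m y * (partialDeriv (remPart φ m x) j y
      - ((d + 1 : ℝ) / (2 * ‖y - x‖ ^ 2) * partialDeriv (fun z => ‖z - x‖ ^ 2) j y) •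
        remPart φ m x y)
    = -∑ m, ∑ j, (a j m y - a j m x) * (linCoeff φ x j m
      - ((d + 1 : ℝ) / (2 * ‖y - x‖ ^ 2) * partialDeriv (fun z => ‖z - x‖ ^ 2) j y) •
        linPart φ m x y)

/-- The integral representation
`f(x) = ∫_{∂D} f(y) ∑_m (∑_j a^j_m(y) ∂/∂y_j) ⌟ (φ_m(x, y) / N(y - x)^n dV)`; here
`(∑_j a^j ∂/∂y_j) ⌟ (h dV) = ∑_j (-1)^(j-1) a^j h dy_1 ∧ … ∧ (dy_j omitted) ∧ … ∧ dy_n`. -/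
def HasIntegralRepresentation (N : Space d → ℝ) (D : Set (Space d))
    (a : Fin (d + 1) → Fin q → Space d → A) (φ : Fin q → Space d → Space d → A)
    (f : Space d → A) (x : Space d) : Prop :=
  HasBoundaryIntegral D
    (fun j y => f y * ∑ m, a j m y * ((N (y - x) ^ (d + 1))⁻¹ • φ m x y)) (f x)

end Conditions

/-! ### The commutative case

`α` is an `n × q` matrix with `q = r + 1` and `n = q + t`. The bijection `e` singles out `q` of its
rows (the "first" ones, `e (inl l)`) and numbers the other ones (`e (inr k)`, row "`q + k`"). -/

section Commutative

variable {d r t : ℕ} {A : Type*} [CommRing A]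

/-- The square matrix of the `q` selected rows. -/
def mainBlock (e : Fin (r + 1) ⊕ Fin t ≃ Fin (d + 1))
    (α : Matrix (Fin (d + 1)) (Fin (r + 1)) A) : Matrix (Fin (r + 1)) (Fin (r + 1)) A :=
  fun l => α (e (Sum.inl l))

/-- `D_0`. -/
def D0 (e : Fin (r + 1) ⊕ Fin t ≃ Fin (d + 1))
    (α : Matrix (Fin (d + 1)) (Fin (r + 1)) A) : A :=
  (mainBlock e α).det

/-- `D^k_m`: the row `m` of `D_0` is deleted and the row `q + k` is added at the bottom. -/
def Dkm (e : Fin (r + 1) ⊕ Fin t ≃ Fin (d + 1))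
    (α : Matrix (Fin (d + 1)) (Fin (r + 1)) A) (k : Fin t) (m : Fin (r + 1)) : A :=
  Matrix.det (Fin.snoc (α := fun _ => Fin (r + 1) → A)
    (fun l : Fin r => mainBlock e α (m.succAbove l)) (α (e (Sum.inr k))))

/-- The minor of `D_0` with the row `l` and the column `m` deleted. -/
def minor (e : Fin (r + 1) ⊕ Fin t ≃ Fin (d + 1))
    (α : Matrix (Fin (d + 1)) (Fin (r + 1)) A) (l m : Fin (r + 1)) : A :=
  ((mainBlock e α).submatrix l.succAbove m.succAbove).det

/-- The conditions (A): `∑_m D^l_m D^k_m + δ^l_k D_0² = 0` for all `k, l`. -/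
def CondA (e : Fin (r + 1) ⊕ Fin t ≃ Fin (d + 1))
    (α : Matrix (Fin (d + 1)) (Fin (r + 1)) A) : Prop :=
  ∀ k l : Fin t, ∑ m, Dkm e α l m * Dkm e α k m + (if l = k then D0 e α ^ 2 else 0) = 0

/-- The coefficients `c^l_i` with `l` one of the `q` selected rows and `i` arbitrary, from their
values `γ` for `i` among the selected rows: for `i = q + k`,
`c^l_i = -c^i_l = -D_0⁻¹ ∑_m (-1)^(q+m) D^k_m c^m_l` (in the formula `q` and `m` count from `1`). -/
def cCoeff (e : Fin (r + 1) ⊕ Fin t ≃ Fin (d + 1))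
    (α : Matrix (Fin (d + 1)) (Fin (r + 1)) A) (γ : Matrix (Fin (r + 1)) (Fin (r + 1)) A)
    (l : Fin (r + 1)) (i : Fin (d + 1)) : A :=
  Sum.elim (fun l' => γ l l')
    (fun k => -(Ring.inverse (D0 e α) *
      ∑ m : Fin (r + 1), (-1) ^ (r + (m : ℕ)) * Dkm e α k m * γ m l)) (e.symm i)

/-- The determinant obtained from `D_0` by replacing the column `m` by `(c^1_i, …, c^q_i)`. -/
def Dtilde (e : Fin (r + 1) ⊕ Fin t ≃ Fin (d + 1))
    (α : Matrix (Fin (d + 1)) (Fin (r + 1)) A) (γ : Matrix (Fin (r + 1)) (Fin (r + 1)) A)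
    (i : Fin (d + 1)) (m : Fin (r + 1)) : A :=
  ((mainBlock e α).updateCol m fun l => cCoeff e α γ l i).det

variable [Algebra ℝ A]

/-- `γ` has the diagonal entries `1/n`, and is antisymmetric off the diagonal. -/
def IsAdmissible (d : ℕ) (γ : Matrix (Fin (r + 1)) (Fin (r + 1)) A) : Prop :=
  (∀ l, γ l l = (d + 1 : ℝ)⁻¹ • (1 : A)) ∧ ∀ l l', l ≠ l' → γ l l' = -γ l' l

/-- The two determinant formulas
`b^i_m = Vol⁻¹ D_0⁻¹ ∑_l (-1)^(m+l) c^l_i (minor of l, m) = Vol⁻¹ D_0⁻¹ D̃^i_m`. -/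
def IsDeterminantSolution (e : Fin (r + 1) ⊕ Fin t ≃ Fin (d + 1))
    (α : Matrix (Fin (d + 1)) (Fin (r + 1)) A) (γ : Matrix (Fin (r + 1)) (Fin (r + 1)) A)
    (b : Matrix (Fin (d + 1)) (Fin (r + 1)) A) : Prop :=
  ∀ i m,
    b i m = (ballVol (euclideanNorm d))⁻¹ •
      ∑ l : Fin (r + 1), (-1) ^ ((m : ℕ) + (l : ℕ)) * cCoeff e α γ l i *
        Ring.inverse (D0 e α) * minor e α l m ∧
    b i m = (ballVol (euclideanNorm d))⁻¹ • (Ring.inverse (D0 e α) * Dtilde e α γ i m)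

end Commutative

end CauchyAlgebra

end

/-! The integral formula is Cauchy's argument, carried by the divergence theorem. With h_j = f ∑_m
a^j_m φ_m(x,·), the form on the boundary belongs to the field h / N(y-x)^n. Its divergence splits
into a part containing the divergences of f a_m, which vanish by hypothesis, and f times the second
expression of (C2). So the field is divergence free off x. Multiplying it by a cutoff χ(N((y-x)/ε)),
which is 1 on the boundary, and rescaling y = x + εz gives an integral over a fixed compact set. The
value does not depend on ε, and as ε → 0 the quotient h(x+εz)/ε tends to the derivative of h at x,
applied to z. Everything then rests on ∫ N^{-n} ∂_j(χ∘N) z_i dz = δ_ij Vol_N. This follows by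
integration by parts, because N^{-n} ∂_j(χ∘N) is itself the j-th derivative of a compactly supported
function of N, whose integral is computed by Fubini from vol{N < r} = r^n Vol_N. Neither surface
measure nor polar coordinates for N are needed. The result is Vol_N ∑_j ∂_j h_j(x), which is f(x) by
the first part of (C2). The lemmas are `BoundaryAtlas.integral_eq`,
`BoundaryAtlas.integral_eq_setIntegral_gauge`, `BoundaryAtlas.integral_eq_smul_sum` and
`IsSmoothGauge.integral_partialDeriv_cutoffPrimitive`.

The divergence theorem itself is proved patch by patch. Volume preserving coordinates flatten the
graph, a transformed field has the same divergence there, and the theorem on boxes applies. Since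
the result is a volume integral over D, it does not depend on the atlas.

In the Euclidean case, put p_ji = ∑_m a^j_m(x) b^i_m(x). The limit of the second part of (C2) along
a ray x + εz reads tr p = n ‖z‖^{-2} ∑ z_j z_i p_ji. The first part gives the value of tr p, so the
quadratic form of p is a fixed multiple of ‖z‖², and polarization turns this into (C5). What remains
of (C2) is the remainder equation, and the steps reverse.

In the commutative case, Cramer's rule writes row q+k as a combination of the selected rows with
coefficient vector R_k, and (A) says R_k · R_l = -δ_kl. The numbers c^l_i are, up to the factor Vol,
the products of row l with b^i, so Cramer's rule also recovers b from c. (C5) makes c equal to 1/n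
on the diagonal and antisymmetric off it. Symmetrizing the products of the remaining rows therefore
leaves -2/(n Vol) R_k · R_l, and (C5) asks that this be 2δ_kl/(n Vol), which is (A). -/

namespace CauchyAlgebra

/-! ### Cramer's rule for the selected rows, over a commutative ring -/

section Commutative

variable {d r t : ℕ} {A : Type*} [CommRing A]

/-- The coefficients of the row `q + k` with respect to the selected rows. -/
noncomputable def rowCoeff (e : Fin (r + 1) ⊕ Fin t ≃ Fin (d + 1))
    (α : Matrix (Fin (d + 1)) (Fin (r + 1)) A) (k : Fin t) (m : Fin (r + 1)) : A :=
  Ring.inverse (D0 e α) * ((-1) ^ (r + (m : ℕ)) * Dkm e α k m)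

/-- Laplace expansion of both determinants along the row `v` uses the same minors; only the signs
differ, by the parity of the move from position `m` to the last one. -/
theorem det_updateRow_eq_det_snoc (M : Matrix (Fin (r + 1)) (Fin (r + 1)) A) (m : Fin (r + 1))
    (v : Fin (r + 1) → A) :
    (M.updateRow m v).det = (-1) ^ (r + (m : ℕ)) *
      Matrix.det (Fin.snoc (α := fun _ => Fin (r + 1) → A) (fun l : Fin r => M (m.succAbove l)) v) := by
  refine (Matrix.det_succ_row _ m).trans (Eq.trans ?_
    (congrArg (_ * ·) (Matrix.det_succ_row _ (Fin.last r))).symm)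
  refine Eq.trans (Finset.sum_congr rfl fun j _ => ?_) (Finset.mul_sum _ _ _).symm
  have h1 : (M.updateRow m v).submatrix m.succAbove j.succAbove =
      Matrix.submatrix (Fin.snoc (α := fun _ => Fin (r + 1) → A)
        (fun l : Fin r => M (m.succAbove l)) v) (Fin.last r).succAbove j.succAbove := by
    ext a b
    simp only [Matrix.submatrix_apply, Matrix.updateRow_ne (Fin.succAbove_ne m a),
      Fin.succAbove_last]
    exact (congrFun (Fin.snoc_castSucc (α := fun _ => Fin (r + 1) → A) v
      (fun l : Fin r => M (m.succAbove l)) a) _).symm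
  rw [h1, Matrix.updateRow_self]
  simp only [Fin.snoc_last, Fin.val_last]
  have h2 : ((-1 : A)) ^ (r + (m : ℕ)) * (-1) ^ (r + (j : ℕ)) = (-1) ^ ((m : ℕ) + j) := by
    rw [← pow_add, show r + (m : ℕ) + (r + j) = 2 * r + (m + j) by ring, pow_add, pow_mul]
    simp
  rw [← h2]; ring

/-- Cramer's rule for the transposed block: the coefficients are determinants with one row replaced,
brought into the shape `Dkm` by moving the new row to the bottom. -/
theorem row_eq_sum_rowCoeff (e : Fin (r + 1) ⊕ Fin t ≃ Fin (d + 1))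
    (α : Matrix (Fin (d + 1)) (Fin (r + 1)) A) (hu : IsUnit (D0 e α)) (k : Fin t)
    (j : Fin (r + 1)) :
    α (e (Sum.inr k)) j = ∑ m, rowCoeff e α k m * α (e (Sum.inl m)) j := by
  have h := congrFun (Matrix.mulVec_cramer (mainBlock e α).transpose (α (e (Sum.inr k)))) j
  rw [Matrix.det_transpose] at h
  change _ = D0 e α * α (e (Sum.inr k)) j at h
  have h3 : α (e (Sum.inr k)) j = Ring.inverse (D0 e α) * (D0 e α * α (e (Sum.inr k)) j) := by
    rw [← mul_assoc, Ring.inverse_mul_cancel _ hu, one_mul]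
  rw [h3, ← h, Matrix.mulVec, dotProduct, Finset.mul_sum]
  refine Finset.sum_congr rfl fun m _ => ?_
  rw [Matrix.cramer_transpose_apply, det_updateRow_eq_det_snoc, rowCoeff, Dkm]
  simp only [Matrix.transpose_apply, mainBlock]
  ring

/-- The signs enter squared, so (A) divided by D_0² says that the coefficient vectors are orthogonal
with square -1. All later arguments use (A) in this form. -/
theorem condA_iff_rowCoeff (e : Fin (r + 1) ⊕ Fin t ≃ Fin (d + 1))
    (α : Matrix (Fin (d + 1)) (Fin (r + 1)) A) (hu : IsUnit (D0 e α)) :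
    CondA e α ↔ ∀ k l, ∑ m, rowCoeff e α k m * rowCoeff e α l m = if l = k then -1 else 0 := by
  have key : ∀ k l, ∑ m, rowCoeff e α k m * rowCoeff e α l m =
      Ring.inverse (D0 e α) ^ 2 * ∑ m, Dkm e α l m * Dkm e α k m := by
    intro k l
    rw [Finset.mul_sum]
    refine Finset.sum_congr rfl fun m _ => ?_
    have h2 : ((-1 : A)) ^ (r + (m : ℕ)) * (-1) ^ (r + (m : ℕ)) = 1 := by
      rw [← mul_pow]; simp
    rw [rowCoeff, rowCoeff]
    linear_combination (Ring.inverse (D0 e α) ^ 2 * Dkm e α l m * Dkm e α k m) * h2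
  have hi := Ring.inverse_mul_cancel _ hu
  refine forall₂_congr fun k l => ?_
  rw [key]
  constructor
  · intro h
    split_ifs at h ⊢ with hkl
    -- With u = D_0⁻¹ D_0, the factor u + 1 comes from u² - 1 = (u + 1)(u - 1).
    · linear_combination (Ring.inverse (D0 e α) ^ 2) * h -
        (Ring.inverse (D0 e α) * D0 e α + 1) * hi
    · linear_combination (Ring.inverse (D0 e α) ^ 2) * h
  · intro h
    split_ifs at h ⊢ with hkl
    · linear_combination (D0 e α ^ 2) * h - (∑ m, Dkm e α l m * Dkm e α k m) *
        (Ring.inverse (D0 e α) * D0 e α + 1) * hi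
    · linear_combination (D0 e α ^ 2) * h - (∑ m, Dkm e α l m * Dkm e α k m) *
        (Ring.inverse (D0 e α) * D0 e α + 1) * hi

theorem cCoeff_inl (e : Fin (r + 1) ⊕ Fin t ≃ Fin (d + 1))
    (α : Matrix (Fin (d + 1)) (Fin (r + 1)) A) (γ : Matrix (Fin (r + 1)) (Fin (r + 1)) A)
    (l l' : Fin (r + 1)) : cCoeff e α γ l (e (Sum.inl l')) = γ l l' := by
  simp [cCoeff]

theorem cCoeff_inr (e : Fin (r + 1) ⊕ Fin t ≃ Fin (d + 1))
    (α : Matrix (Fin (d + 1)) (Fin (r + 1)) A) (γ : Matrix (Fin (r + 1)) (Fin (r + 1)) A)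
    (l : Fin (r + 1)) (k : Fin t) :
    cCoeff e α γ l (e (Sum.inr k)) = -∑ m, rowCoeff e α k m * γ m l := by
  simp only [cCoeff, Equiv.symm_apply_apply, Sum.elim_inr, Finset.mul_sum, rowCoeff, mul_assoc]

theorem Dtilde_eq_sum (e : Fin (r + 1) ⊕ Fin t ≃ Fin (d + 1))
    (α : Matrix (Fin (d + 1)) (Fin (r + 1)) A) (γ : Matrix (Fin (r + 1)) (Fin (r + 1)) A)
    (i : Fin (d + 1)) (m : Fin (r + 1)) :
    Dtilde e α γ i m = ∑ l : Fin (r + 1), (-1) ^ ((m : ℕ) + (l : ℕ)) * cCoeff e α γ l i *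
      minor e α l m := by
  rw [Dtilde, Matrix.det_succ_column _ m]
  refine Finset.sum_congr rfl fun l _ => ?_
  have h1 : ((mainBlock e α).updateCol m fun l => cCoeff e α γ l i).submatrix
      l.succAbove m.succAbove = (mainBlock e α).submatrix l.succAbove m.succAbove := by
    ext a b
    simp [Matrix.submatrix_apply]
  rw [h1, Matrix.updateCol_self, minor, add_comm (m : ℕ)]

theorem sum_row_inr (e : Fin (r + 1) ⊕ Fin t ≃ Fin (d + 1))
    (α : Matrix (Fin (d + 1)) (Fin (r + 1)) A) (hu : IsUnit (D0 e α))
    (b : Fin (r + 1) → A) (k : Fin t) :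
    ∑ m, α (e (Sum.inr k)) m * b m =
      ∑ l, rowCoeff e α k l * ∑ m, α (e (Sum.inl l)) m * b m := by
  simp only [row_eq_sum_rowCoeff e α hu k, Finset.sum_mul, Finset.mul_sum]
  rw [Finset.sum_comm]
  simp only [mul_assoc]

/-- A double sum against a matrix that is antisymmetric off its constant diagonal. -/
theorem sum_sum_add_swap {ι : Type*} [Fintype ι] [DecidableEq ι] (X Y : ι → A) (g : ι → ι → A)
    (c : A) (hd : ∀ i, g i i = c) (ha : ∀ i j, i ≠ j → g i j = -g j i) :
    (∑ m, X m * ∑ p, Y p * g p m) + ∑ m, Y m * ∑ p, X p * g p m = 2 * c * ∑ m, X m * Y m := by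
  have h1 : ∑ m, Y m * ∑ p, X p * g p m = ∑ m, X m * ∑ p, Y p * g m p := by
    simp only [Finset.mul_sum]
    rw [Finset.sum_comm]
    exact Finset.sum_congr rfl fun _ _ => Finset.sum_congr rfl fun _ _ => by ring
  rw [h1, ← Finset.sum_add_distrib, Finset.mul_sum]
  refine Finset.sum_congr rfl fun m _ => ?_
  rw [← mul_add, ← Finset.sum_add_distrib, Finset.sum_eq_single m]
  · rw [hd]; ring
  · intro p _ hp
    rw [ha p m hp]; ring
  · simp

variable [Algebra ℝ A]

/-- Both determinant formulas are Cramer's rule for the linear system with matrix `mainBlock e α`,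
unknown b^i and right side c_i / Vol. This trades them for equations between products of rows, the
form in which (C5) is stated. -/
theorem isDeterminantSolution_iff (e : Fin (r + 1) ⊕ Fin t ≃ Fin (d + 1))
    (α : Matrix (Fin (d + 1)) (Fin (r + 1)) A) (γ : Matrix (Fin (r + 1)) (Fin (r + 1)) A)
    (b : Matrix (Fin (d + 1)) (Fin (r + 1)) A) (hu : IsUnit (D0 e α)) :
    IsDeterminantSolution e α γ b ↔ ∀ i l, ∑ m, α (e (Sum.inl l)) m * b i m =
      (ballVol (euclideanNorm d))⁻¹ • cCoeff e α γ l i := by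
  have hi := Ring.inverse_mul_cancel _ hu
  set V := (ballVol (euclideanNorm d))⁻¹
  have h1 : IsDeterminantSolution e α γ b ↔
      ∀ i m, b i m = V • (Ring.inverse (D0 e α) * Dtilde e α γ i m) := by
    refine forall₂_congr fun i m => ⟨fun h => h.2, fun h => ⟨?_, h⟩⟩
    rw [h, Dtilde_eq_sum, Finset.mul_sum]
    congr 1
    exact Finset.sum_congr rfl fun l _ => by ring
  rw [h1]
  refine forall_congr' fun i => ?_
  have hD : ∀ m, Dtilde e α γ i m =
      Matrix.cramer (mainBlock e α) (fun l => cCoeff e α γ l i) m := fun m => by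
    rw [Matrix.cramer_apply, Dtilde]
  constructor
  · intro h l
    have h2 := congrFun (Matrix.mulVec_cramer (mainBlock e α) (fun l => cCoeff e α γ l i)) l
    change _ = D0 e α * cCoeff e α γ l i at h2
    have h3 : cCoeff e α γ l i = Ring.inverse (D0 e α) * (D0 e α * cCoeff e α γ l i) := by
      rw [← mul_assoc, hi, one_mul]
    rw [h3, ← h2, Matrix.mulVec, dotProduct, Finset.mul_sum, Finset.smul_sum]
    refine Finset.sum_congr rfl fun m _ => ?_
    rw [h, hD, mul_smul_comm]
    congr 1
    simp only [mainBlock]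
    ring
  · intro h m
    have h2 : (mainBlock e α).mulVec (b i) = V • fun l => cCoeff e α γ l i := by
      ext l
      exact h l
    have h4 : D0 e α * b i m = V • Dtilde e α γ i m := by
      rw [hD, ← Pi.smul_apply, ← (Matrix.cramer (mainBlock e α)).map_smul_of_tower, ← h2,
        Matrix.cramer_eq_adjugate_mulVec, Matrix.mulVec_mulVec, Matrix.adjugate_mul,
        Matrix.smul_mulVec, Matrix.one_mulVec]
      rfl
    rw [← mul_smul_comm, ← h4, ← mul_assoc, hi, one_mul]

theorem eq_of_two_mul_eq {x y : A} (h : 2 * x = 2 * y) : x = y := by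
  have h2 := congrArg (fun z => (2⁻¹ : ℝ) • z) h
  have h3 : ∀ z : A, (2⁻¹ : ℝ) • (2 * z) = z := fun z => by
    rw [two_mul, smul_add, ← add_smul]; norm_num
  simpa [h3] using h2

/-- Expanding the row q+k and then c_{q+l} makes this product a bilinear form in the two coefficient
vectors, with matrix γ. By `sum_sum_add_swap` its symmetrization sees only the diagonal of γ. -/
theorem sum_row_inr_mul_inr (e : Fin (r + 1) ⊕ Fin t ≃ Fin (d + 1))
    (α : Matrix (Fin (d + 1)) (Fin (r + 1)) A) (hu : IsUnit (D0 e α))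
    (b : Matrix (Fin (d + 1)) (Fin (r + 1)) A) (γ : Matrix (Fin (r + 1)) (Fin (r + 1)) A)
    (hb : IsDeterminantSolution e α γ b) (k l : Fin t) :
    ∑ m, α (e (Sum.inr k)) m * b (e (Sum.inr l)) m =
      -((ballVol (euclideanNorm d))⁻¹ • ∑ m, rowCoeff e α k m *
        ∑ p, rowCoeff e α l p * γ p m) := by
  rw [isDeterminantSolution_iff e α γ b hu] at hb
  rw [sum_row_inr e α hu]
  simp only [hb, cCoeff_inr, smul_neg, mul_neg, Finset.sum_neg_distrib,
    mul_smul_comm, ← Finset.smul_sum]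

end Commutative

/-! ### The conditions (C5) and (A) in a commutative algebra -/

section CommutativeNormed

variable {d r t : ℕ} {A : Type*} [NormedCommRing A] [NormedAlgebra ℝ A]

theorem condC5_antisymm (α b : Matrix (Fin (d + 1)) (Fin (r + 1)) A) (h : CondC5 α b) {i j : Fin (d + 1)}
    (hij : i ≠ j) : ∑ m, α j m * b i m = -∑ m, α i m * b j m := by
  have := h.2 i j hij
  rw [Finset.sum_add_distrib] at this
  exact eq_neg_of_add_eq_zero_left this

theorem exists_admissible_of_condC5 (e : Fin (r + 1) ⊕ Fin t ≃ Fin (d + 1))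
    (α b : Matrix (Fin (d + 1)) (Fin (r + 1)) A) (hV : ballVol (euclideanNorm d) ≠ 0)
    (hu : IsUnit (D0 e α)) (h : CondC5 α b) :
    CondA e α ∧ ∃ γ, IsAdmissible d γ ∧ IsDeterminantSolution e α γ b := by
  set V := ballVol (euclideanNorm d) with hVdef
  -- The only possible choice, read off from the linear system that b has to satisfy.
  let γ : Matrix (Fin (r + 1)) (Fin (r + 1)) A := fun l l' =>
    V • ∑ m, α (e (Sum.inl l)) m * b (e (Sum.inl l')) m
  have hγ : IsAdmissible d γ := by
    constructor
    · intro l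
      simp only [γ]
      rw [h.1, smul_smul, mul_inv, mul_comm, mul_assoc, inv_mul_cancel₀ hV, mul_one]
    · intro l l' hl
      simp only [γ]
      rw [condC5_antisymm α b h (i := e (Sum.inl l')) (j := e (Sum.inl l))
        (by simpa using hl.symm), smul_neg]
  have hdet : IsDeterminantSolution e α γ b := by
    rw [isDeterminantSolution_iff e α γ b hu]
    intro i l
    obtain ⟨i', rfl⟩ := e.surjective i
    rcases i' with l' | k
    · rw [cCoeff_inl, smul_smul, inv_mul_cancel₀ hV, one_smul]
    -- (C5) exchanges the row l and the row q+k, after which the row q+k is expanded in the selected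
    -- rows.
    · rw [condC5_antisymm α b h (by simp), sum_row_inr e α hu, cCoeff_inr, smul_neg, neg_inj,
        Finset.smul_sum]
      refine Finset.sum_congr rfl fun m _ => ?_
      rw [← mul_smul_comm]
      simp only [γ]
      rw [smul_smul, inv_mul_cancel₀ hV, one_smul]
  refine ⟨?_, γ, hγ, hdet⟩
  rw [condA_iff_rowCoeff e α hu]
  intro k l
  have h1 := sum_row_inr_mul_inr e α hu b γ hdet k l
  have h2 := sum_row_inr_mul_inr e α hu b γ hdet l k
  have h3 := sum_sum_add_swap (rowCoeff e α k) (rowCoeff e α l) γ _ hγ.1 hγ.2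
  -- The symmetrized product of two remaining rows is evaluated twice: here by (C5), and through γ
  -- by `h1`, `h2`, `h3`. The comparison is (A).
  have h4 : (∑ m, α (e (Sum.inr k)) m * b (e (Sum.inr l)) m) +
      ∑ m, α (e (Sum.inr l)) m * b (e (Sum.inr k)) m =
      if l = k then (2 * (((d + 1 : ℝ) * V)⁻¹ • (1 : A))) else 0 := by
    split_ifs with hkl
    · subst hkl
      rw [h.1, two_mul]
    · rw [condC5_antisymm α b h (by simpa using hkl), neg_add_cancel]
  rw [h1, h2, ← neg_add, ← smul_add, h3] at h4
  have h5 : ((d + 1 : ℝ) * V) • (if l = k then (2 * (((d + 1 : ℝ) * V)⁻¹ • (1 : A))) else 0) =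
      2 * (if l = k then 1 else 0) := by
    split_ifs
    · rw [← mul_smul_comm, smul_smul, mul_inv_cancel₀ (by positivity), one_smul]
    · simp
  rw [← h4] at h5
  apply eq_of_two_mul_eq
  have h6 : (d + 1 : ℝ) ≠ 0 := by positivity
  simp only [smul_neg, mul_smul_comm, smul_mul_assoc, smul_smul, mul_one] at h5
  rw [show (d + 1 : ℝ) * V * (V⁻¹ * (d + 1 : ℝ)⁻¹) = 1 by field_simp, one_smul] at h5
  rw [← neg_eq_iff_eq_neg.mpr (h5.trans (neg_neg _).symm).symm]
  split_ifs <;> simp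

theorem exists_solution_of_condA (e : Fin (r + 1) ⊕ Fin t ≃ Fin (d + 1))
    (α : Matrix (Fin (d + 1)) (Fin (r + 1)) A)
    (hu : IsUnit (D0 e α)) (h : CondA e α) (γ : Matrix (Fin (r + 1)) (Fin (r + 1)) A)
    (hγ : IsAdmissible d γ) :
    ∃ b, IsDeterminantSolution e α γ b ∧ CondC5 α b := by
  set V := ballVol (euclideanNorm d) with hVdef
  let b : Matrix (Fin (d + 1)) (Fin (r + 1)) A :=
    fun i m => V⁻¹ • (Ring.inverse (D0 e α) * Dtilde e α γ i m)
  have hdet : IsDeterminantSolution e α γ b := by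
    refine fun i m => ⟨?_, rfl⟩
    simp only [b]
    rw [Dtilde_eq_sum, Finset.mul_sum]
    congr 1
    exact Finset.sum_congr rfl fun l _ => by ring
  have hS := (isDeterminantSolution_iff e α γ b hu).1 hdet
  rw [condA_iff_rowCoeff e α hu] at h
  -- Products of two remaining rows are the only ones where (A) is needed; those involving a
  -- selected row satisfy (C5) by the choice of c. For k = l this is twice the diagonal condition.
  have hrr : ∀ k l, (∑ m, α (e (Sum.inr k)) m * b (e (Sum.inr l)) m) +
      ∑ m, α (e (Sum.inr l)) m * b (e (Sum.inr k)) m =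
      if l = k then 2 * (((d + 1 : ℝ) * V)⁻¹ • (1 : A)) else 0 := by
    intro k l
    rw [sum_row_inr_mul_inr e α hu b γ hdet k l, sum_row_inr_mul_inr e α hu b γ hdet l k,
      ← neg_add, ← smul_add, sum_sum_add_swap _ _ γ _ hγ.1 hγ.2, h k l]
    split_ifs
    · rw [mul_neg, mul_one, smul_neg, neg_neg, mul_smul_comm, mul_smul_comm, smul_smul, mul_inv,
        mul_comm (V⁻¹), mul_one]
    · simp
  refine ⟨b, hdet, ?_, ?_⟩
  · intro j
    obtain ⟨j', rfl⟩ := e.surjective j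
    rcases j' with l | k
    · rw [hS, cCoeff_inl, hγ.1, smul_smul, mul_inv, mul_comm]
    · have := hrr k k
      rw [if_pos rfl, ← two_mul] at this
      exact eq_of_two_mul_eq this
  · intro i j hij
    obtain ⟨i, rfl⟩ := e.surjective i
    obtain ⟨j, rfl⟩ := e.surjective j
    rw [Finset.sum_add_distrib]
    rcases i with i | i <;> rcases j with j | j
    · rw [hS, hS, cCoeff_inl, cCoeff_inl, hγ.2 i j (by simpa using hij), smul_neg, add_neg_cancel]
    · rw [sum_row_inr e α hu, hS, cCoeff_inr]
      simp only [hS, cCoeff_inl, mul_smul_comm, ← Finset.smul_sum, smul_neg, add_neg_cancel]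
    · rw [sum_row_inr e α hu, hS, cCoeff_inr]
      simp only [hS, cCoeff_inl, mul_smul_comm, ← Finset.smul_sum, smul_neg, neg_add_cancel]
    · rw [add_comm, hrr, if_neg (by simpa using hij.symm)]

end CommutativeNormed

open MeasureTheory Set Filter Topology

/-! ### Functions that are `C¹` up to the boundary -/

section Regularity

variable {d : ℕ} {F : Type*} [NormedAddCommGroup F] [NormedSpace ℝ F]

/-- Near each point of the closure there is a derivative within the closure that is continuous at
that point, hence locally bounded; compactness makes the bound global. It gives the integrability
that the divergence theorem on boxes requires. -/
theorem exists_bound_fderiv {D : Set (Space d)} (hD : IsOpen D) (hb : Bornology.IsBounded D)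
    {G : Space d → F} (hG : ContDiffOn ℝ 1 G (closure D)) :
    ∃ C, ∀ y ∈ D, ‖fderiv ℝ G y‖ ≤ C := by
  have hloc : ∀ p ∈ closure D, ∃ V ∈ 𝓝[closure D] p, ∃ C, ∀ y ∈ V ∩ D, ‖fderiv ℝ G y‖ ≤ C := by
    intro p hp
    have h1 : ContDiffWithinAt ℝ (0 + 1) G (closure D) p := by simpa using hG p hp
    obtain ⟨u, hu, -, f', hf', hc⟩ := (contDiffWithinAt_succ_iff_hasFDerivWithinAt (by simp)).1 h1
    rw [insert_eq_of_mem hp] at hu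
    have hpu : p ∈ u := mem_of_mem_nhdsWithin hp hu
    have hev : ∀ᶠ y in 𝓝[u] p, ‖f' y‖ < ‖f' p‖ + 1 :=
      hc.continuousWithinAt.norm.eventually (gt_mem_nhds (lt_add_one _))
    obtain ⟨o, ho, hpo, hou⟩ := mem_nhdsWithin.1 hu
    have hev' : ∀ᶠ y in 𝓝[closure D] p, ‖f' y‖ < ‖f' p‖ + 1 ∧ y ∈ u ∧ y ∈ o := by
      have h2 : 𝓝[closure D] p ≤ 𝓝[u] p := by
        rw [nhdsWithin_le_iff]; exact hu
      filter_upwards [h2 hev, hu, mem_nhdsWithin_of_mem_nhds (ho.mem_nhds hpo)] with y h3 h4 h5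
      exact ⟨h3, h4, h5⟩
    refine ⟨_, hev', ‖f' p‖ + 1, ?_⟩
    rintro y ⟨⟨hy1, hy2, hy3⟩, hyD⟩
    -- The chosen derivative within the closure agrees with `fderiv` at points of D because D is
    -- open.
    have hnu : u ∈ 𝓝 y := mem_of_superset ((ho.inter hD).mem_nhds ⟨hy3, hyD⟩)
      fun z hz => hou ⟨hz.1, subset_closure hz.2⟩
    rw [((hf' y hy2).hasFDerivAt hnu).fderiv]
    exact hy1.le
  have hcomp : IsCompact (closure D) := hb.isCompact_closure
  have key : ∃ C, ∀ y ∈ closure D ∩ D, ‖fderiv ℝ G y‖ ≤ C := by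
    refine hcomp.induction_on (p := fun s => ∃ C, ∀ y ∈ s ∩ D, ‖fderiv ℝ G y‖ ≤ C) ⟨0, by simp⟩
      (fun s t hst ⟨C, hC⟩ => ⟨C, fun y hy => hC y ⟨hst hy.1, hy.2⟩⟩) ?_ hloc
    rintro s t ⟨C, hC⟩ ⟨C', hC'⟩
    refine ⟨max C C', ?_⟩
    rintro y ⟨hy | hy, hyD⟩
    · exact (hC y ⟨hy, hyD⟩).trans (le_max_left _ _)
    · exact (hC' y ⟨hy, hyD⟩).trans (le_max_right _ _)
  obtain ⟨C, hC⟩ := key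
  exact ⟨C, fun y hy => hC y ⟨subset_closure hy, hy⟩⟩

theorem contDiffAt_of_mem {D : Set (Space d)} (hD : IsOpen D) {G : Space d → F}
    (hG : ContDiffOn ℝ 1 G (closure D)) {y : Space d} (hy : y ∈ D) : ContDiffAt ℝ 1 G y :=
  (hG.mono subset_closure).contDiffAt (hD.mem_nhds hy)

theorem continuousOn_partialDeriv {D : Set (Space d)} (hD : IsOpen D) {G : Space d → F}
    (hG : ContDiffOn ℝ 1 G (closure D)) (j : Fin (d + 1)) : ContinuousOn (partialDeriv G j) D :=
  ((hG.mono subset_closure).continuousOn_fderiv_of_isOpen hD le_rfl).clm_apply continuousOn_const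

theorem integrableOn_partialDeriv {D : Set (Space d)} (hD : IsOpen D)
    (hb : Bornology.IsBounded D) {G : Space d → F} (hG : ContDiffOn ℝ 1 G (closure D))
    (j : Fin (d + 1)) : IntegrableOn (partialDeriv G j) D := by
  obtain ⟨C, hC⟩ := exists_bound_fderiv hD hb hG
  refine IntegrableOn.of_bound (hb.measure_lt_top)
    ((continuousOn_partialDeriv hD hG j).aestronglyMeasurable hD.measurableSet) C ?_
  refine (ae_restrict_iff' hD.measurableSet).2 (ae_of_all _ fun y hy => ?_)
  refine ((fderiv ℝ G y).le_opNorm _).trans ?_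
  simpa using hC y hy

end Regularity

/-! ### The coordinates of a boundary patch -/

namespace BoundaryPatch

variable {d : ℕ} {D : Set (Space d)} (P : BoundaryPatch D)

/-- The projection of `ℝⁿ` that forgets the coordinate `k`. -/
noncomputable def proj : (Fin (d + 1) → ℝ) →L[ℝ] (Fin d → ℝ) :=
  ContinuousLinearMap.pi fun i => ContinuousLinearMap.proj (P.k.succAbove i)

/-- The coordinates in which the graph is the hyperplane `v_k = 0`, and `D` the side `v_k > 0`. -/
noncomputable def coord (v : Fin (d + 1) → ℝ) : Space d :=
  WithLp.toLp 2 v + (P.γ (P.proj v) - (P.s + 1) * v P.k) • EuclideanSpace.single P.k (1 : ℝ)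

/-- The derivative of `coord`. -/
noncomputable def coordDeriv (v : Fin (d + 1) → ℝ) : (Fin (d + 1) → ℝ) →L[ℝ] Space d :=
  ((EuclideanSpace.equiv (Fin (d + 1)) ℝ).symm : (Fin (d + 1) → ℝ) →L[ℝ] Space d) +
    ((fderiv ℝ P.γ (P.proj v)).comp P.proj -
      (P.s + 1) • ContinuousLinearMap.proj (R := ℝ) (φ := fun _ : Fin (d + 1) => ℝ)
        P.k).smulRight (EuclideanSpace.single P.k (1 : ℝ))

theorem s_mul_s : P.s * P.s = 1 := by
  rcases P.s_eq with h | h <;> simp [h]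

theorem proj_apply (v : Fin (d + 1) → ℝ) (i : Fin d) : P.proj v i = v (P.k.succAbove i) := rfl

theorem coord_k (v : Fin (d + 1) → ℝ) : P.coord v P.k = P.γ (P.proj v) - P.s * v P.k := by
  simp [coord]; ring

theorem coord_succAbove (v : Fin (d + 1) → ℝ) (i : Fin d) :
    P.coord v (P.k.succAbove i) = v (P.k.succAbove i) := by
  simp [coord]

theorem coord_insertNth_zero (t : Fin d → ℝ) :
    P.coord (P.k.insertNth (α := fun _ => ℝ) 0 t) = P.param t := by
  have hp : P.proj (P.k.insertNth (α := fun _ => ℝ) 0 t) = t := by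
    ext i; simp [proj_apply]
  ext i
  refine Fin.succAboveCases P.k ?_ (fun j => ?_) i
  · rw [coord_k, hp]; simp [param]
  · rw [coord_succAbove]; simp [param]

theorem continuous_coord : Continuous P.coord := by
  have := P.γ_smooth.continuous
  unfold coord
  fun_prop

theorem hasFDerivAt_coord (v : Fin (d + 1) → ℝ) : HasFDerivAt P.coord (P.coordDeriv v) v := by
  have h1 : HasFDerivAt P.γ (fderiv ℝ P.γ (P.proj v)) (P.proj v) :=
    (P.γ_smooth.differentiable (by simp) _).hasFDerivAt
  have h2 := (h1.comp v P.proj.hasFDerivAt).sub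
    (((ContinuousLinearMap.proj (R := ℝ) (φ := fun _ : Fin (d + 1) => ℝ) P.k).hasFDerivAt
      (x := v)).const_mul (P.s + 1))
  exact ((EuclideanSpace.equiv (Fin (d + 1)) ℝ).symm :
    (Fin (d + 1) → ℝ) →L[ℝ] Space d).hasFDerivAt.add (h2.smul_const _)

theorem coordDeriv_k (v : Fin (d + 1) → ℝ) :
    P.coordDeriv v (Pi.single P.k 1) = -P.s • EuclideanSpace.single P.k (1 : ℝ) := by
  have hp : P.proj (Pi.single P.k 1) = 0 := by
    ext i; simp [proj_apply]
  simp only [coordDeriv, _root_.add_apply, ContinuousLinearMap.smulRight_apply,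
    _root_.sub_apply, ContinuousLinearMap.comp_apply, hp, map_zero,
    _root_.smul_apply, ContinuousLinearMap.proj_apply]
  ext i
  simp [EuclideanSpace.equiv]
  split_ifs <;> simp

theorem coordDeriv_succAbove (v : Fin (d + 1) → ℝ) (i : Fin d) :
    P.coordDeriv v (Pi.single (P.k.succAbove i) 1) =
      EuclideanSpace.single (P.k.succAbove i) (1 : ℝ) +
        fderiv ℝ P.γ (P.proj v) (Pi.single i 1) • EuclideanSpace.single P.k (1 : ℝ) := by
  have hp : P.proj (Pi.single (P.k.succAbove i) 1) = Pi.single i 1 := by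
    ext j; simp [proj_apply, Pi.single_apply]
  simp only [coordDeriv, _root_.add_apply, ContinuousLinearMap.smulRight_apply,
    _root_.sub_apply, ContinuousLinearMap.comp_apply, hp,
    _root_.smul_apply, ContinuousLinearMap.proj_apply]
  ext i
  simp [EuclideanSpace.equiv]

/-- The map is a shear combined, when s = 1, with a reflection: for fixed y' it acts on the
coordinate k as u ↦ γ(y') - s u, which preserves length. -/
theorem measurePreserving_coord : MeasurePreserving P.coord := by
  have h1 := volume_preserving_piFinSuccAbove (fun _ : Fin (d + 1) => ℝ) P.k
  have h2 : MeasurePreserving (fun p : (Fin d → ℝ) × ℝ => (p.1, P.γ p.1 - P.s * p.2)) := by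
    refine (MeasurePreserving.id volume).skew_product
      (g := fun (t : Fin d → ℝ) (u : ℝ) => P.γ t - P.s * u) ?_ (ae_of_all _ fun t => ?_)
    · have := P.γ_smooth.continuous
      exact Continuous.measurable (by fun_prop)
    · rcases P.s_eq with h | h
      · simp only [h, one_mul]
        exact (Measure.measurePreserving_sub_left volume (P.γ t)).map_eq
      · simp only [h, neg_mul, one_mul, sub_neg_eq_add]
        exact (measurePreserving_add_left volume (P.γ t)).map_eq
  have h3 := (PiLp.volume_preserving_toLp (Fin (d + 1))).comp
    (h1.symm.comp ((Measure.measurePreserving_swap).comp (h2.comp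
      ((Measure.measurePreserving_swap).comp h1))))
  convert h3 using 1
  ext v i
  refine Fin.succAboveCases P.k ?_ (fun j => ?_) i
  · rw [coord_k]
    simp
    rfl
  · rw [coord_succAbove]
    simp
    rfl

theorem coord_mem_iff {v : Fin (d + 1) → ℝ} (hv : P.coord v ∈ P.U) :
    P.coord v ∈ D ↔ 0 < v P.k := by
  have h1 : P.coord v ∈ D ↔ P.coord v ∈ D ∩ P.U := by simp [hv]
  have h2 : (fun i => P.coord v (P.k.succAbove i)) = P.proj v := by
    ext i; rw [coord_succAbove, proj_apply]
  rw [h1, P.inter_eq, mem_ofPred_eq, h2, coord_k]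
  have h3 : P.s * (P.γ (P.proj v) - P.s * v P.k - P.γ (P.proj v)) = - v P.k := by
    linear_combination (-v P.k) * P.s_mul_s
  rw [h3]
  simp [hv]

/-- A point with v_k = 0 is a limit of points v + ε e_k, which are mapped into D as long as they
stay in the patch. -/
theorem coord_mem_closure {v : Fin (d + 1) → ℝ} (hv : P.coord v ∈ P.U) (h0 : 0 ≤ v P.k) :
    P.coord v ∈ closure D := by
  have hcl : v ∈ closure {w : Fin (d + 1) → ℝ | 0 < w P.k} := by
    have ht : Tendsto (fun ε : ℝ => v + ε • (Pi.single P.k 1 : Fin (d + 1) → ℝ)) (𝓝[>] 0)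
        (𝓝 v) := by
      have : Tendsto (fun ε : ℝ => v + ε • (Pi.single P.k 1 : Fin (d + 1) → ℝ)) (𝓝 0)
          (𝓝 (v + (0 : ℝ) • (Pi.single P.k 1 : Fin (d + 1) → ℝ))) :=
        Continuous.tendsto (by fun_prop) _
      simp only [zero_smul, add_zero] at this
      exact this.mono_left nhdsWithin_le_nhds
    refine mem_closure_of_tendsto ht ?_
    filter_upwards [self_mem_nhdsWithin] with ε hε
    simp only [Pi.add_apply, Pi.smul_apply, Pi.single_eq_same, smul_eq_mul, mul_one]
    exact add_pos_of_nonneg_of_pos h0 hε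
  have ho : IsOpen (P.coord ⁻¹' P.U) := P.isOpen_U.preimage P.continuous_coord
  have := ho.inter_closure ⟨hv, hcl⟩
  exact map_mem_closure P.continuous_coord this fun w hw => (P.coord_mem_iff hw.1).2 hw.2

theorem param_mem_frontier (hD : IsOpen D) {t : Fin d → ℝ} (ht : P.param t ∈ P.U) :
    P.param t ∈ frontier D := by
  rw [hD.frontier_eq]
  rw [← coord_insertNth_zero] at ht ⊢
  exact ⟨P.coord_mem_closure ht (by simp), fun h => by simpa using (P.coord_mem_iff ht).1 h⟩

theorem contDiff_normal (j : Fin (d + 1)) : ContDiff ℝ 1 fun t => P.normal t j := by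
  refine Fin.succAboveCases P.k ?_ (fun i => ?_) j
  · simp only [normal, Fin.insertNth_apply_same]
    exact contDiff_const
  · simp only [normal, Fin.insertNth_apply_succAbove]
    exact contDiff_const.mul ((P.γ_smooth.fderiv_right (m := 1) (by norm_cast)).clm_apply contDiff_const)

/-- The coordinates have an explicit continuous left inverse, so the preimage of a compact set lies
in a cube. This supplies the box for the divergence theorem. -/
theorem exists_bound_of_coord_mem {K : Set (Space d)} (hK : IsCompact K) :
    ∃ R, 0 < R ∧ ∀ v, P.coord v ∈ K → ∀ i, |v i| < R := by
  let inv : Space d → Fin (d + 1) → ℝ := fun y =>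
    WithLp.ofLp y + (P.s * (P.γ (P.proj (WithLp.ofLp y)) - y P.k) - y P.k) • Pi.single P.k 1
  have hc : Continuous inv := by
    have := P.γ_smooth.continuous
    fun_prop
  have hinv : ∀ v, inv (P.coord v) = v := by
    intro v
    have hp : P.proj (WithLp.ofLp (P.coord v)) = P.proj v := by
      ext i; exact P.coord_succAbove v i
    ext i
    refine Fin.succAboveCases P.k ?_ (fun j => ?_) i
    · simp only [inv, hp, Pi.add_apply, Pi.smul_apply, Pi.single_eq_same, coord_k, smul_eq_mul]
      linear_combination v P.k * P.s_mul_s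
    · simp only [inv, Pi.add_apply, Pi.smul_apply, coord_succAbove]
      simp
  obtain ⟨C, hC⟩ := hK.exists_bound_of_continuousOn hc.continuousOn
  refine ⟨|C| + 1, by positivity, fun v hv i => ?_⟩
  have h1 := hC _ hv
  rw [hinv] at h1
  have h2 := norm_le_pi_norm v i
  rw [Real.norm_eq_abs] at h2
  linarith [le_abs_self C]

end BoundaryPatch

/-! ### The divergence theorem in one patch -/

section Patch

section

variable {d : ℕ} {D : Set (Space d)} {A : Type*} [NormedAddCommGroup A] [NormedSpace ℝ A]

open Classical in
/-- The derivative of `H` on `D`, extended by zero. -/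
noncomputable def innerDeriv (D : Set (Space d)) (H : Space d → A) (y : Space d) : Space d →L[ℝ] A :=
  if y ∈ D then fderiv ℝ H y else 0

theorem innerDeriv_apply_single (H : Space d → A) (y : Space d) (j : Fin (d + 1)) :
    innerDeriv D H y (EuclideanSpace.single j 1) = D.indicator (partialDeriv H j) y := by
  by_cases hy : y ∈ D <;> simp [innerDeriv, hy, partialDeriv]

end

variable {d : ℕ} {D : Set (Space d)} {A : Type*} [NormedAddCommGroup A]

namespace BoundaryPatch

variable (P : BoundaryPatch D)

/-- Near S the half space is mapped into the closure of D, where H is continuous; away from S the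
function is zero. The indicator discards the values of H outside the closure, about which nothing is
known. -/
theorem continuousOn_indicator_comp_coord {H : Space d → A} {S : Set (Space d)}
    (hH : ContinuousOn H (closure D)) (hS : IsClosed S) (hSU : S ⊆ P.U)
    (h0 : ∀ y ∉ S, H y = 0) :
    ContinuousOn (fun v => (closure D).indicator H (P.coord v)) {v | 0 ≤ v P.k} := by
  intro v hv
  by_cases hvS : P.coord v ∈ S
  · have hU := hSU hvS
    have hcl := P.coord_mem_closure hU hv
    have hev : ∀ᶠ w in 𝓝[{v | 0 ≤ v P.k}] v, P.coord w ∈ closure D := by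
      filter_upwards [self_mem_nhdsWithin, mem_nhdsWithin_of_mem_nhds
        (P.continuous_coord.continuousAt.preimage_mem_nhds (P.isOpen_U.mem_nhds hU))] with w h1 h2
      exact P.coord_mem_closure h2 h1
    have h1 : ContinuousWithinAt (fun v => H (P.coord v)) {v | 0 ≤ v P.k} v := by
      refine Tendsto.comp (hH _ hcl) (tendsto_nhdsWithin_iff.2 ⟨?_, hev⟩)
      exact P.continuous_coord.continuousAt.mono_left nhdsWithin_le_nhds
    refine h1.congr_of_eventuallyEq ?_ (indicator_of_mem hcl _)
    filter_upwards [hev] with w hw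
    exact indicator_of_mem hw _
  · have hev : ∀ᶠ w in 𝓝 v, (closure D).indicator H (P.coord w) = 0 := by
      filter_upwards [P.continuous_coord.continuousAt.preimage_mem_nhds
        (hS.isOpen_compl.mem_nhds hvS)] with w hw
      rw [indicator_apply_eq_zero]
      exact fun _ => h0 _ hw
    have : ContinuousAt (fun v => (closure D).indicator H (P.coord v)) v :=
      (continuousAt_const (y := (0 : A))).congr (hev.mono fun _ h => h.symm)
    exact this.continuousWithinAt

variable [NormedSpace ℝ A]

theorem hasFDerivAt_indicator_comp_coord (hD : IsOpen D) {H : Space d → A} {S : Set (Space d)}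
    (hH : ContDiffOn ℝ 1 H (closure D)) (hS : IsClosed S) (hSU : S ⊆ P.U)
    (h0 : ∀ y ∉ S, H y = 0) {v : Fin (d + 1) → ℝ} (hv : 0 < v P.k) :
    HasFDerivAt (fun v => (closure D).indicator H (P.coord v))
      ((innerDeriv D H (P.coord v)).comp (P.coordDeriv v)) v := by
  by_cases hvS : P.coord v ∈ S
  · have hvD := (P.coord_mem_iff (hSU hvS)).2 hv
    have h1 : HasFDerivAt H (innerDeriv D H (P.coord v)) (P.coord v) := by
      rw [innerDeriv, if_pos hvD]
      exact ((contDiffAt_of_mem hD hH hvD).differentiableAt (by simp)).hasFDerivAt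
    refine (h1.comp v (P.hasFDerivAt_coord v)).congr_of_eventuallyEq ?_
    filter_upwards [P.continuous_coord.continuousAt.preimage_mem_nhds (hD.mem_nhds hvD)] with w hw
    exact indicator_of_mem (subset_closure (show P.coord w ∈ D from hw)) H
  · have hev0 : H =ᶠ[𝓝 (P.coord v)] fun _ => (0 : A) := by
      filter_upwards [hS.isOpen_compl.mem_nhds hvS] with y hy using h0 y hy
    have hd : innerDeriv D H (P.coord v) = 0 := by
      rw [innerDeriv]
      split_ifs
      · rw [hev0.fderiv_eq, fderiv_fun_const]; rfl
      · rfl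
    rw [hd, ContinuousLinearMap.zero_comp]
    refine (hasFDerivAt_const (0 : A) v).congr_of_eventuallyEq ?_
    filter_upwards [P.continuous_coord.continuousAt.eventually hev0] with w hw
    rw [indicator_apply_eq_zero]
    exact fun _ => hw

/-- The divergence theorem for a field supported in a patch. -/
theorem integral_normal_eq [CompleteSpace A] (hD : IsOpen D) (hb : Bornology.IsBounded D)
    {H : Fin (d + 1) → Space d → A} {S : Set (Space d)}
    (hH : ∀ j, ContDiffOn ℝ 1 (H j) (closure D)) (hS : IsClosed S) (hSU : S ⊆ P.U)
    (h0 : ∀ j, ∀ y ∉ S, H j y = 0) :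
    ∫ t, ∑ j, P.normal t j • H j (P.param t) = ∫ y in D, ∑ j, partialDeriv (H j) j y := by
  classical
  have hK : IsCompact (closure D ∩ S) := hb.isCompact_closure.inter_right hS
  obtain ⟨R, hR, hRK⟩ := P.exists_bound_of_coord_mem hK
  set W : Fin (d + 1) → (Fin (d + 1) → ℝ) → A :=
    fun j v => (closure D).indicator (H j) (P.coord v) with hW
  have hW0 : ∀ j v i, R ≤ |v i| → W j v = 0 := by
    intro j v i hi
    simp only [hW]
    by_contra hne
    have hcl := mem_of_indicator_ne_zero hne
    rw [indicator_of_mem hcl] at hne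
    have hvS : P.coord v ∈ S := by
      by_contra hvS
      exact hne (h0 j _ hvS)
    exact absurd (hRK v ⟨hcl, hvS⟩ i) (not_lt.2 hi)
  set ν : Fin (d + 1) → (Fin (d + 1) → ℝ) → ℝ := fun j v => P.normal (P.proj v) j with hν
  set ν' : Fin (d + 1) → (Fin (d + 1) → ℝ) → (Fin (d + 1) → ℝ) →L[ℝ] ℝ :=
    fun j v => (fderiv ℝ (fun t => P.normal t j) (P.proj v)).comp P.proj with hν'
  have hνd : ∀ j v, HasFDerivAt (ν j) (ν' j v) v := fun j v =>
    (((P.contDiff_normal j).differentiable (by simp) _).hasFDerivAt).comp v P.proj.hasFDerivAt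
  set W' : Fin (d + 1) → (Fin (d + 1) → ℝ) → (Fin (d + 1) → ℝ) →L[ℝ] A :=
    fun j v => (innerDeriv D (H j) (P.coord v)).comp (P.coordDeriv v) with hW'
  -- The Piola transform of the field for a map with Jacobian determinant of modulus 1: its
  -- component k is minus the product with the normal, the others are unchanged. On v_k = 0 the
  -- component k is therefore the boundary integrand up to sign.
  set f : Fin (d + 1) → (Fin (d + 1) → ℝ) → A :=
    fun i v => if i = P.k then -∑ j, ν j v • W j v else W i v with hf
  set f' : Fin (d + 1) → (Fin (d + 1) → ℝ) → (Fin (d + 1) → ℝ) →L[ℝ] A :=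
    fun i v => if i = P.k then -∑ j, (ν j v • W' j v + (ν' j v).smulRight (W j v)) else W' i v
    with hf'
  -- The box is 0 ≤ v_k ≤ R and |v_i| ≤ R for the other i, so that one face lies on the graph and
  -- the field vanishes on all the others.
  set a : Fin (d + 1) → ℝ := fun i => if i = P.k then 0 else -R with ha
  set b : Fin (d + 1) → ℝ := fun _ => R with hbdef
  -- The divergence is unchanged: the normal does not depend on v_k, so its derivative drops out,
  -- and the terms with ∂_i γ from the component k cancel those of the other components.
  have hdiv : ∀ v, ∑ i, f' i v (Pi.single i 1) =
      D.indicator (fun y => ∑ j, partialDeriv (H j) j y) (P.coord v) := by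
    intro v
    have hp : P.proj (Pi.single P.k 1) = 0 := by
      ext i; simp [proj_apply]
    have e1 : f' P.k v (Pi.single P.k 1) = P.s • ∑ j, ν j v •
        innerDeriv D (H j) (P.coord v) (EuclideanSpace.single P.k 1) := by
      simp only [hf', if_true, _root_.neg_apply, _root_.sum_apply, _root_.add_apply,
        _root_.smul_apply, ContinuousLinearMap.smulRight_apply, hν', hW',
        ContinuousLinearMap.comp_apply, hp, map_zero, zero_smul, add_zero, coordDeriv_k, map_smul,
        Finset.smul_sum, ← Finset.sum_neg_distrib]
      refine Finset.sum_congr rfl fun j _ => ?_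
      rw [neg_smul, smul_neg, neg_neg, smul_comm]
    have e2 : ∀ i, f' (P.k.succAbove i) v (Pi.single (P.k.succAbove i) 1) =
        innerDeriv D (H (P.k.succAbove i)) (P.coord v)
          (EuclideanSpace.single (P.k.succAbove i) 1) + fderiv ℝ P.γ (P.proj v) (Pi.single i 1) •
        innerDeriv D (H (P.k.succAbove i)) (P.coord v) (EuclideanSpace.single P.k 1) := by
      intro i
      simp only [hf', if_neg (Fin.succAbove_ne P.k i), hW', ContinuousLinearMap.comp_apply,
        coordDeriv_succAbove, map_add, map_smul]
    have e3 : D.indicator (fun y => ∑ j, partialDeriv (H j) j y) (P.coord v) =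
        ∑ j, innerDeriv D (H j) (P.coord v) (EuclideanSpace.single j 1) := by
      simp only [innerDeriv_apply_single]
      by_cases hv : P.coord v ∈ D <;> simp [hv]
    rw [e3, Fin.sum_univ_succAbove _ P.k, Fin.sum_univ_succAbove _ P.k, e1,
      Fin.sum_univ_succAbove _ P.k]
    simp only [e2, hν, normal, Fin.insertNth_apply_same, Fin.insertNth_apply_succAbove, smul_add,
      smul_smul, P.s_mul_s, one_smul, Finset.smul_sum, Finset.sum_add_distrib]
    have e4 : ∀ z, P.s * (-P.s * z) = -z := fun z => by
      rw [neg_mul, mul_neg, ← mul_assoc, P.s_mul_s, one_mul]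
    simp only [e4, neg_smul, Finset.sum_neg_distrib]
    abel
  have hint : IntegrableOn (fun y => ∑ j, partialDeriv (H j) j y) D :=
    integrable_finsetSum _ fun j _ => integrableOn_partialDeriv hD hb (hH j) j
  have hint' : Integrable (D.indicator (fun y => ∑ j, partialDeriv (H j) j y)) :=
    hint.integrable_indicator hD.measurableSet
  have hint'' := (P.measurePreserving_coord.integrable_comp hint'.aestronglyMeasurable).2 hint'
  have hIcc : ∀ v ∈ Icc a b, 0 ≤ v P.k := fun v hv => by simpa [ha] using hv.1 P.k
  have main := integral_divergence_of_hasFDerivAt_off_countable' a b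
    (fun i => by simp only [ha, hbdef]; split_ifs <;> linarith) f f' ∅ countable_empty
    (fun i => by
      have hWc : ∀ j, ContinuousOn (W j) (Icc a b) := fun j =>
        (P.continuousOn_indicator_comp_coord (hH j).continuousOn hS hSU (h0 j)).mono hIcc
      have hνc : ∀ j, Continuous (ν j) := fun j =>
        (P.contDiff_normal j).continuous.comp P.proj.continuous
      simp only [hf]
      split_ifs
      · exact (continuousOn_finsetSum _ fun j _ => (hνc j).continuousOn.smul (hWc j)).neg
      · exact hWc i)
    (fun v hv i => by
      have hvk : 0 < v P.k := by
        have := (hv.1 P.k (mem_univ _)).1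
        simpa [ha] using this
      have hWd : ∀ j, HasFDerivAt (W j) (W' j v) v := fun j =>
        P.hasFDerivAt_indicator_comp_coord hD (hH j) hS hSU (h0 j) hvk
      simp only [hf, hf']
      split_ifs
      · exact (HasFDerivAt.fun_sum fun j _ => (hνd j v).smul (hWd j)).neg
      · exact hWd i)
    (by
      simp only [hdiv]
      exact hint''.integrableOn)
  simp only [hdiv] at main
  -- Change of variables; the pulled back divergence vanishes outside the box because the support of
  -- the field meets the closure of D in a compact set.
  have hRHS : ∫ y in D, ∑ j, partialDeriv (H j) j y = ∫ v in Icc a b,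
      D.indicator (fun y => ∑ j, partialDeriv (H j) j y) (P.coord v) := by
    rw [← integral_indicator hD.measurableSet, ← P.measurePreserving_coord.map_eq,
      integral_map P.continuous_coord.measurable.aemeasurable
        (by rw [P.measurePreserving_coord.map_eq]; exact hint'.aestronglyMeasurable)]
    symm
    refine setIntegral_eq_integral_of_forall_compl_eq_zero fun v hv => ?_
    by_contra hne
    have hvD := mem_of_indicator_ne_zero hne
    rw [indicator_of_mem hvD] at hne
    have hvS : P.coord v ∈ S := by
      by_contra hvS
      refine hne (Finset.sum_eq_zero fun j _ => ?_)
      have hev0 : H j =ᶠ[𝓝 (P.coord v)] fun _ => (0 : A) := by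
        filter_upwards [hS.isOpen_compl.mem_nhds hvS] with y hy using h0 j y hy
      rw [partialDeriv, hev0.fderiv_eq]
      simp
    have hvk := (P.coord_mem_iff (hSU hvS)).1 hvD
    have hlt := hRK v ⟨subset_closure hvD, hvS⟩
    refine hv ⟨fun i => ?_, fun i => (abs_lt.1 (hlt i)).2.le⟩
    simp only [ha]
    split_ifs with hi
    · rw [hi]; exact hvk.le
    · exact (abs_lt.1 (hlt i)).1.le
  -- Among the faces only v_k = 0 contributes.
  rw [hRHS, main, Finset.sum_eq_single P.k]
  · have hz : ∀ x, f P.k (P.k.insertNth (b P.k) x) = 0 := by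
      intro x
      simp only [hf, if_true]
      rw [Finset.sum_eq_zero, neg_zero]
      intro j _
      rw [hW0 j _ P.k (by simp [hbdef, abs_of_pos hR]), smul_zero]
    have hpar : ∀ x j, W j (P.k.insertNth (α := fun _ => ℝ) 0 x) = H j (P.param x) := by
      intro x j
      simp only [hW, coord_insertNth_zero]
      by_cases hx : P.param x ∈ S
      · exact indicator_of_mem (frontier_subset_closure (P.param_mem_frontier hD (hSU hx))) _
      · rw [h0 j _ hx, indicator_apply_eq_zero]
        exact fun _ => h0 j _ hx
    have hl : ∀ x, f P.k (P.k.insertNth (a P.k) x) = -∑ j, P.normal x j • H j (P.param x) := by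
      intro x
      have hp : P.proj (P.k.insertNth (α := fun _ => ℝ) 0 x) = x := by
        ext i; simp [proj_apply]
      simp only [hf, if_true, ha, hpar, hν, hp]
    simp only [hz, hl, integral_zero, integral_neg, sub_neg_eq_add, zero_add]
    symm
    refine setIntegral_eq_integral_of_forall_compl_eq_zero fun x hx => ?_
    refine Finset.sum_eq_zero fun j _ => ?_
    rw [← hpar]
    have : ∃ i, R ≤ |x i| := by
      by_contra! hcon
      refine hx ⟨fun i => ?_, fun i => (abs_lt.1 (hcon i)).2.le⟩
      simp only [ha, Function.comp_apply, if_neg (Fin.succAbove_ne P.k i)]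
      exact (abs_lt.1 (hcon i)).1.le
    obtain ⟨i, hi⟩ := this
    rw [hW0 j _ (P.k.succAbove i) (by simpa using hi), smul_zero]
  · intro i _ hi
    have hz : ∀ c x, R ≤ |c| → f i (i.insertNth c x) = 0 := by
      intro c x hc
      simp only [hf, if_neg hi]
      exact hW0 _ _ i (by simpa using hc)
    simp only [hz _ _ (show R ≤ |b i| by simp [hbdef, abs_of_pos hR]),
      hz _ _ (show R ≤ |a i| by simp [ha, if_neg hi, abs_of_pos hR]), integral_zero, sub_zero]
  · simp

end BoundaryPatch

end Patch

theorem IsSmoothBoundedDomain.nonempty_boundaryAtlas {d : ℕ} {D : Set (Space d)}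
    (hD : IsSmoothBoundedDomain D) : Nonempty (BoundaryAtlas D) := by
  have hcomp : IsCompact (frontier D) :=
    hD.isBounded.isCompact_closure.of_isClosed_subset isClosed_frontier frontier_subset_closure
  choose P hP using hD.smooth
  obtain ⟨t, ht⟩ := hcomp.elim_nhds_subcover' (fun p hp => (P p hp).U)
    fun p hp => (P p hp).isOpen_U.mem_nhds (hP p hp)
  let e := t.equivFin
  let Q : Fin t.card → BoundaryPatch D := fun i => P (e.symm i).1.1 (e.symm i).1.2
  obtain ⟨f, hf⟩ := SmoothPartitionOfUnity.exists_isSubordinate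
    (modelWithCornersSelf ℝ (Space d)) (isClosed_frontier (s := D)) (fun i => (Q i).U)
    (fun i => (Q i).isOpen_U) (by
      intro y hy
      obtain ⟨x, hx, hyx⟩ := mem_iUnion₂.1 (ht hy)
      refine mem_iUnion.2 ⟨e ⟨x, hx⟩, ?_⟩
      simpa [Q] using hyx)
  exact ⟨⟨t.card, Q, fun i => f i, fun i => (f i).contMDiff.contDiff, fun i y => f.nonneg i y, hf,
    fun y hy => by rw [← finsum_eq_sum_of_fintype]; exact f.sum_eq_one hy⟩⟩

/-- The domain itself as a patch that does not meet its boundary. -/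
theorem exists_patch_eq_self {d : ℕ} {D : Set (Space d)} (hD : IsOpen D)
    (hb : Bornology.IsBounded D) : ∃ P : BoundaryPatch D, P.U = D := by
  obtain ⟨R, hR⟩ := hb.exists_norm_le
  -- The constant graph y_0 = R + 1 lies above all of D, so D is on its lower side.
  refine ⟨⟨D, hD, 0, 1, Or.inl rfl, fun _ => R + 1, contDiff_const, ?_⟩, rfl⟩
  ext y
  simp only [inter_self, one_mul, mem_ofPred_eq]
  refine ⟨fun hy => ⟨hy, ?_⟩, fun hy => hy.1⟩
  have h1 := PiLp.norm_apply_le y (0 : Fin (d + 1))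
  rw [Real.norm_eq_abs] at h1
  linarith [hR y hy, le_abs_self (y 0)]

/-! ### The divergence theorem on the whole domain -/

section Divergence

variable {d : ℕ} {D : Set (Space d)} {A : Type*} [NormedAddCommGroup A] [NormedSpace ℝ A]

theorem integral_divergence_sum (hD : IsOpen D) (hb : Bornology.IsBounded D) {ι : Type*}
    [Fintype ι] {F : ι → Fin (d + 1) → Space d → A} {G : Fin (d + 1) → Space d → A}
    (hF : ∀ i j, ContDiffOn ℝ 1 (F i j) (closure D))
    (hG : ∀ j, ∀ y ∈ D, G j y = ∑ i, F i j y) :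
    ∫ y in D, ∑ j, partialDeriv (G j) j y = ∑ i, ∫ y in D, ∑ j, partialDeriv (F i j) j y := by
  rw [← integral_finsetSum _ fun i _ => integrable_finsetSum _ fun j _ =>
    integrableOn_partialDeriv hD hb (hF i j) j]
  refine setIntegral_congr_fun hD.measurableSet fun y hy => ?_
  rw [Finset.sum_comm]
  refine Finset.sum_congr rfl fun j _ => ?_
  have hev : G j =ᶠ[𝓝 y] fun z => ∑ i, F i j z := by
    filter_upwards [hD.mem_nhds hy] with z hz using hG j z hz
  simp only [partialDeriv]
  rw [hev.fderiv_eq, fderiv_fun_sum fun i _ =>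
    (contDiffAt_of_mem hD (hF i j) hy).differentiableAt (by simp)]
  simp

theorem contDiffOn_smul {χ : Space d → ℝ} (hχ : ContDiff ℝ ∞ χ) {G : Space d → A}
    (hG : ContDiffOn ℝ 1 G (closure D)) : ContDiffOn ℝ 1 (fun y => χ y • G y) (closure D) :=
  (hχ.of_le (by norm_cast)).contDiffOn.smul hG

theorem BoundaryPatch.integral_smul_normal_eq [CompleteSpace A] (P : BoundaryPatch D)
    (hD : IsOpen D) (hb : Bornology.IsBounded D) {G : Fin (d + 1) → Space d → A}
    (hG : ∀ j, ContDiffOn ℝ 1 (G j) (closure D)) {χ : Space d → ℝ} (hχ : ContDiff ℝ ∞ χ)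
    (hsupp : tsupport χ ⊆ P.U) :
    ∫ t, χ (P.param t) • ∑ j, P.normal t j • G j (P.param t) =
      ∫ y in D, ∑ j, partialDeriv (fun y => χ y • G j y) j y := by
  rw [← P.integral_normal_eq hD hb (fun j => contDiffOn_smul hχ (hG j)) (isClosed_tsupport χ) hsupp
    fun j y hy => by rw [image_eq_zero_of_notMem_tsupport hy, zero_smul]]
  simp only [Finset.smul_sum]
  congr 1
  ext t
  exact Finset.sum_congr rfl fun j _ => smul_comm _ _ _

/-- The divergence theorem for fields that vanish on the boundary. -/
theorem BoundaryAtlas.integral_divergence_eq_zero [CompleteSpace A] (T : BoundaryAtlas D)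
    (hD : IsOpen D) (hb : Bornology.IsBounded D) {G : Fin (d + 1) → Space d → A}
    (hG : ∀ j, ContDiffOn ℝ 1 (G j) (closure D)) (h0 : ∀ j, ∀ y ∈ frontier D, G j y = 0) :
    ∫ y in D, ∑ j, partialDeriv (G j) j y = 0 := by
  -- The domain and the boundary patches cover the closure. With a partition of unity for this
  -- cover, each piece reduces to an integral over a graph, where the cutoff or the field vanishes.
  obtain ⟨P₀, hP₀⟩ := exists_patch_eq_self hD hb
  let Q : Option (Fin T.card) → BoundaryPatch D := fun o => o.elim P₀ T.patch
  obtain ⟨ψ, hψ⟩ := SmoothPartitionOfUnity.exists_isSubordinate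
    (modelWithCornersSelf ℝ (Space d)) (isClosed_closure (s := D)) (fun o => (Q o).U)
    (fun o => (Q o).isOpen_U) (by
      intro y hy
      by_cases hyD : y ∈ D
      · exact mem_iUnion.2 ⟨none, by simpa [Q, hP₀] using hyD⟩
      · have hyf : y ∈ frontier D := by rw [hD.frontier_eq]; exact ⟨hy, hyD⟩
        have : ∃ i, T.χ i y ≠ 0 := by
          by_contra! hcon
          have := T.χ_sum y hyf
          simp [hcon] at this
        obtain ⟨i, hi⟩ := this
        exact mem_iUnion.2 ⟨some i, T.χ_support i (subset_tsupport _ hi)⟩)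
  have hψs : ∀ o, ContDiff ℝ ∞ (ψ o) := fun o => (ψ o).contMDiff.contDiff
  rw [integral_divergence_sum hD hb (F := fun o j y => ψ o y • G j y)
    (fun o j => contDiffOn_smul (hψs o) (hG j))]
  · refine Finset.sum_eq_zero fun o _ => ?_
    rw [← (Q o).integral_smul_normal_eq hD hb hG (hψs o) (hψ o)]
    refine (integral_congr_ae (ae_of_all _ fun t => ?_)).trans (integral_zero _ _)
    by_cases ht : ψ o ((Q o).param t) = 0
    · simp [ht]
    · have hf := (Q o).param_mem_frontier hD (hψ o (subset_tsupport _ ht))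
      simp [h0 _ _ hf]
  · intro j y hy
    rw [← Finset.sum_smul, ← finsum_eq_sum_of_fintype, ψ.sum_eq_one (subset_closure hy), one_smul]

/-- The divergence theorem on a bounded domain with smooth boundary. -/
theorem BoundaryAtlas.integral_eq [CompleteSpace A] (T : BoundaryAtlas D) (hD : IsOpen D)
    (hb : Bornology.IsBounded D) {G : Fin (d + 1) → Space d → A}
    (hG : ∀ j, ContDiffOn ℝ 1 (G j) (closure D)) :
    T.integral G = ∫ y in D, ∑ j, partialDeriv (G j) j y := by
  -- The functions χ_i sum to 1 only on the boundary. The remaining piece (1 - ∑ χ_i) G vanishes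
  -- there, but not necessarily near it, so it calls for the version for fields that are zero on the
  -- boundary.
  have hσ : ContDiff ℝ ∞ fun y => 1 - ∑ i, T.χ i y :=
    contDiff_const.sub (ContDiff.sum fun i _ => T.χ_smooth i)
  have h1 : T.integral G = ∑ i, ∫ y in D, ∑ j, partialDeriv (fun y => T.χ i y • G j y) j y :=
    Finset.sum_congr rfl fun i _ =>
      (T.patch i).integral_smul_normal_eq hD hb hG (T.χ_smooth i) (T.χ_support i)
  have h2 := integral_divergence_sum hD hb
    (F := fun (o : Option (Fin T.card)) j y =>
      o.elim (1 - ∑ i, T.χ i y) (fun i => T.χ i y) • G j y) (G := G)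
    (by
      intro o j
      cases o with
      | none => exact contDiffOn_smul hσ (hG j)
      | some i => exact contDiffOn_smul (T.χ_smooth i) (hG j))
    (by
      intro j y _
      rw [← Finset.sum_smul, Fintype.sum_option]
      simp)
  rw [Fintype.sum_option] at h2
  simp only [Option.elim] at h2
  rw [T.integral_divergence_eq_zero hD hb (fun j => contDiffOn_smul hσ (hG j)), zero_add] at h2
  · rw [h1, h2]
  · intro j y hy
    rw [T.χ_sum y hy, sub_self, zero_smul]

end Divergence

/-! ### Gauges -/

theorem isSmoothGauge_euclideanNorm (d : ℕ) : IsSmoothGauge (euclideanNorm d) where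
  nonneg y := norm_nonneg y
  homogeneous c y := by simp [euclideanNorm, norm_smul]
  eq_zero y h := norm_eq_zero.1 h
  contDiffOn := fun y hy => (contDiffAt_norm ℝ hy).contDiffWithinAt

namespace IsSmoothGauge

variable {d : ℕ} {N : Space d → ℝ} (hN : IsSmoothGauge N)

include hN

theorem map_zero : N 0 = 0 := by
  simpa using hN.homogeneous 0 0

theorem pos {y : Space d} (hy : y ≠ 0) : 0 < N y :=
  (hN.nonneg y).lt_of_ne fun h => hy (hN.eq_zero y h.symm)

theorem contDiffAt {y : Space d} (hy : y ≠ 0) : ContDiffAt ℝ 1 N y :=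
  hN.contDiffOn.contDiffAt (isOpen_compl_singleton.mem_nhds hy)

theorem map_eq_norm_mul {y : Space d} (hy : y ≠ 0) : N y = ‖y‖ * N (‖y‖⁻¹ • y) := by
  have h : ‖y‖ ≠ 0 := norm_ne_zero_iff.2 hy
  rw [hN.homogeneous, abs_of_nonneg (by positivity), ← mul_assoc, mul_inv_cancel₀ h, one_mul]

theorem continuousOn_sphere : ContinuousOn N (Metric.sphere (0 : Space d) 1) :=
  hN.contDiffOn.continuousOn.mono fun y hy h => by
    rw [mem_singleton_iff.1 h] at hy
    simp at hy

theorem exists_le_mul_norm : ∃ C, 0 ≤ C ∧ ∀ y, N y ≤ C * ‖y‖ := by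
  obtain ⟨C, hC⟩ := (isCompact_sphere (0 : Space d) 1).exists_bound_of_continuousOn
    hN.continuousOn_sphere
  refine ⟨|C|, abs_nonneg C, fun y => ?_⟩
  rcases eq_or_ne y 0 with rfl | hy
  · simp [hN.map_zero]
  · rw [hN.map_eq_norm_mul hy, mul_comm]
    have h : ‖y‖ ≠ 0 := norm_ne_zero_iff.2 hy
    have h1 := hC (‖y‖⁻¹ • y) (by simp [norm_smul, h])
    have h2 := (le_abs_self _).trans (h1.trans (le_abs_self C))
    gcongr

theorem exists_mul_norm_le : ∃ c, 0 < c ∧ ∀ y, c * ‖y‖ ≤ N y := by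
  obtain ⟨p, hp, hmin⟩ := (isCompact_sphere (0 : Space d) 1).exists_isMinOn
    (NormedSpace.sphere_nonempty.2 zero_le_one) hN.continuousOn_sphere
  have hp0 : p ≠ 0 := by
    rintro rfl
    simp at hp
  refine ⟨N p, hN.pos hp0, fun y => ?_⟩
  rcases eq_or_ne y 0 with rfl | hy
  · simp [hN.map_zero]
  · rw [hN.map_eq_norm_mul hy, mul_comm]
    have h : ‖y‖ ≠ 0 := norm_ne_zero_iff.2 hy
    have h1 : N p ≤ N (‖y‖⁻¹ • y) := hmin (show ‖y‖⁻¹ • y ∈ Metric.sphere (0 : Space d) 1 by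
      simp [norm_smul, h])
    gcongr

theorem continuous : Continuous N := by
  rw [continuous_iff_continuousAt]
  intro y
  rcases eq_or_ne y 0 with rfl | hy
  · obtain ⟨C, -, hC⟩ := hN.exists_le_mul_norm
    rw [ContinuousAt, hN.map_zero]
    refine squeeze_zero hN.nonneg hC ?_
    have : Continuous fun y : Space d => C * ‖y‖ := by fun_prop
    simpa using this.tendsto 0
  · exact (hN.contDiffAt hy).continuousAt

theorem isCompact_le (r : ℝ) : IsCompact {y | N y ≤ r} := by
  obtain ⟨c, hc, hcN⟩ := hN.exists_mul_norm_le
  refine Metric.isCompact_of_isClosed_isBounded (isClosed_le hN.continuous continuous_const) ?_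
  refine (Metric.isBounded_closedBall (x := (0 : Space d)) (r := r / c)).subset fun y hy => ?_
  rw [mem_closedBall_zero_iff, le_div_iff₀ hc, mul_comm]
  exact (hcN y).trans hy

theorem volume_lt_ne_top (r : ℝ) : volume {y : Space d | N y < r} ≠ ⊤ :=
  ((measure_mono fun y (hy : N y < r) => hy.le).trans_lt (hN.isCompact_le r).measure_lt_top).ne

theorem ballVol_pos : 0 < ballVol N := by
  refine ENNReal.toReal_pos ?_ (hN.volume_lt_ne_top 1)
  refine (IsOpen.measure_pos _ (isOpen_lt hN.continuous continuous_const) ⟨0, ?_⟩).ne'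
  simp [hN.map_zero]

theorem volume_lt {r : ℝ} (hr : 0 < r) :
    (volume {y : Space d | N y < r}).toReal = r ^ (d + 1) * ballVol N := by
  have h : {y : Space d | N y < r} = (r⁻¹ • ·) ⁻¹' {y : Space d | N y < 1} := by
    ext y
    simp only [mem_ofPred_eq, mem_preimage, hN.homogeneous, abs_of_pos (inv_pos.2 hr)]
    rw [inv_mul_lt_iff₀ hr, mul_one]
  rw [h, Measure.addHaar_preimage_smul _ (inv_ne_zero hr.ne'), ENNReal.toReal_mul, ballVol,
    ENNReal.toReal_ofReal (abs_nonneg _)]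
  simp [abs_of_pos hr]

/-- N need not be differentiable at the origin; a function that is constant below 1 removes this
singularity. -/
theorem contDiff_comp {ρ : ℝ → ℝ} (hρ : ContDiff ℝ 1 ρ) {c : ℝ} (hc : ∀ s < 1, ρ s = c) :
    ContDiff ℝ 1 fun z => ρ (N z) := by
  rw [contDiff_iff_contDiffAt]
  intro z
  rcases eq_or_ne z 0 with rfl | hz
  · refine (contDiffAt_const (c := c)).congr_of_eventuallyEq ?_
    have h : N 0 < 1 := by rw [hN.map_zero]; norm_num
    filter_upwards [hN.continuous.continuousAt.eventually (gt_mem_nhds h)] with z hz using hc _ hz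
  · exact hρ.contDiffAt.comp z (hN.contDiffAt hz)

theorem partialDeriv_comp {ρ : ℝ → ℝ} (hρ : ContDiff ℝ 1 ρ) {z : Space d} (hz : z ≠ 0)
    (j : Fin (d + 1)) :
    partialDeriv (fun z => ρ (N z)) j z = deriv ρ (N z) * partialDeriv N j z := by
  have h1 : HasDerivAt ρ (deriv ρ (N z)) (N z) := (hρ.differentiable (by simp) _).hasDerivAt
  have h2 := ((hN.contDiffAt hz).differentiableAt (by simp)).hasFDerivAt
  have h3 : HasFDerivAt (fun z => ρ (N z)) _ z := h1.comp_hasFDerivAt z h2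
  rw [partialDeriv, h3.fderiv]
  simp [partialDeriv]

end IsSmoothGauge

/-! ### A radial cutoff function -/

/-- A smooth function that is `0` for `s ≤ 1` and `1` for `s ≥ 2`. -/
noncomputable def cutoff (s : ℝ) : ℝ := Real.smoothTransition (s - 1)

theorem contDiff_cutoff : ContDiff ℝ 1 cutoff :=
  (Real.smoothTransition.contDiff (n := 1)).comp (contDiff_id.sub contDiff_const)

theorem cutoff_eq_zero {s : ℝ} (hs : s ≤ 1) : cutoff s = 0 :=
  Real.smoothTransition.zero_of_nonpos (by linarith)

theorem cutoff_eq_one {s : ℝ} (hs : 2 ≤ s) : cutoff s = 1 :=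
  Real.smoothTransition.one_of_one_le (by linarith)

theorem deriv_cutoff_of_lt {s : ℝ} (hs : s < 1) : deriv cutoff s = 0 := by
  have h : cutoff =ᶠ[𝓝 s] fun _ => 0 := by
    filter_upwards [gt_mem_nhds hs] with r hr using cutoff_eq_zero hr.le
  rw [h.deriv_eq, deriv_const]

theorem deriv_cutoff_of_gt {s : ℝ} (hs : 2 < s) : deriv cutoff s = 0 := by
  have h : cutoff =ᶠ[𝓝 s] fun _ => 1 := by
    filter_upwards [lt_mem_nhds hs] with r hr using cutoff_eq_one hr.le
  rw [h.deriv_eq, deriv_const]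

/-- The derivative of the cutoff function divided by `s ^ n`. -/
noncomputable def cutoffWeight (n : ℕ) (s : ℝ) : ℝ := (s ^ n)⁻¹ * deriv cutoff s

theorem cutoffWeight_of_lt (n : ℕ) {s : ℝ} (hs : s < 1) : cutoffWeight n s = 0 := by
  rw [cutoffWeight, deriv_cutoff_of_lt hs, mul_zero]

theorem cutoffWeight_of_gt (n : ℕ) {s : ℝ} (hs : 2 < s) : cutoffWeight n s = 0 := by
  rw [cutoffWeight, deriv_cutoff_of_gt hs, mul_zero]

theorem continuous_cutoffWeight (n : ℕ) : Continuous (cutoffWeight n) := by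
  rw [continuous_iff_continuousAt]
  intro s
  rcases lt_or_ge s 1 with hs | hs
  · refine (continuousAt_const (y := (0 : ℝ))).congr ?_
    filter_upwards [gt_mem_nhds hs] with r hr using (cutoffWeight_of_lt n hr).symm
  · have h : s ^ n ≠ 0 := by positivity
    exact ((continuousAt_id.pow n).inv₀ h).mul
      (contDiff_cutoff.continuous_deriv le_rfl).continuousAt

/-- The primitive of the weight that vanishes for `s ≥ 2`. -/
noncomputable def cutoffPrimitive (n : ℕ) (s : ℝ) : ℝ := ∫ r in (3 : ℝ)..s, cutoffWeight n r

theorem hasDerivAt_cutoffPrimitive (n : ℕ) (s : ℝ) :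
    HasDerivAt (cutoffPrimitive n) (cutoffWeight n s) s :=
  ((continuous_cutoffWeight n).integral_hasStrictDerivAt 3 s).hasDerivAt

theorem contDiff_cutoffPrimitive (n : ℕ) : ContDiff ℝ 1 (cutoffPrimitive n) := by
  rw [contDiff_one_iff_deriv]
  refine ⟨fun s => (hasDerivAt_cutoffPrimitive n s).differentiableAt, ?_⟩
  rw [show deriv (cutoffPrimitive n) = cutoffWeight n from
    funext fun s => (hasDerivAt_cutoffPrimitive n s).deriv]
  exact continuous_cutoffWeight n

theorem integrable_cutoffWeight (n : ℕ) : Integrable (cutoffWeight n) := by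
  refine (continuous_cutoffWeight n).integrable_of_hasCompactSupport
    (HasCompactSupport.intro (isCompact_Icc (a := 1) (b := 2)) fun s hs => ?_)
  rw [mem_Icc, not_and_or, not_le, not_le] at hs
  exact hs.elim (cutoffWeight_of_lt n) (cutoffWeight_of_gt n)

/-- The starting point 3 lies beyond the support of the weight, so the primitive is minus a tail
integral, the form that suits Fubini. -/
theorem cutoffPrimitive_eq (n : ℕ) (s : ℝ) :
    cutoffPrimitive n s = -∫ r in Ioi s, cutoffWeight n r := by
  have h1 := intervalIntegral.integral_Ioi_sub_Ioi' (a := 3) (b := s)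
    (integrable_cutoffWeight n).integrableOn (integrable_cutoffWeight n).integrableOn
  have h2 : ∫ r in Ioi (3 : ℝ), cutoffWeight n r = 0 :=
    setIntegral_eq_zero_of_forall_eq_zero fun r hr =>
      cutoffWeight_of_gt n (lt_trans (by norm_num) hr)
  rw [cutoffPrimitive, ← h1, h2, zero_sub]

theorem cutoffPrimitive_of_ge (n : ℕ) {s : ℝ} (hs : 2 ≤ s) : cutoffPrimitive n s = 0 := by
  rw [cutoffPrimitive_eq, neg_eq_zero]
  exact setIntegral_eq_zero_of_forall_eq_zero fun r hr => cutoffWeight_of_gt n (hs.trans_lt hr)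

theorem cutoffPrimitive_of_lt (n : ℕ) {s : ℝ} (hs : s < 1) :
    cutoffPrimitive n s = cutoffPrimitive n 1 := by
  rw [cutoffPrimitive_eq, cutoffPrimitive_eq, neg_inj]
  rw [← sub_eq_zero, intervalIntegral.integral_Ioi_sub_Ioi'
    (integrable_cutoffWeight n).integrableOn (integrable_cutoffWeight n).integrableOn,
    intervalIntegral.integral_of_le hs.le, integral_Ioc_eq_integral_Ioo]
  exact setIntegral_eq_zero_of_forall_eq_zero fun r hr => cutoffWeight_of_lt n hr.2

theorem integral_deriv_cutoff : ∫ s, deriv cutoff s = 1 := by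
  have h : Function.support (deriv cutoff) ⊆ Ioc 0 3 := by
    intro s hs
    by_contra hcon
    rw [mem_Ioc, not_and_or, not_lt, not_le] at hcon
    exact hs (hcon.elim (fun h => deriv_cutoff_of_lt (by linarith))
      fun h => deriv_cutoff_of_gt (by linarith))
  rw [← intervalIntegral.integral_eq_integral_of_support_subset h,
    intervalIntegral.integral_deriv_eq_sub
      (fun s _ => contDiff_cutoff.differentiable (by simp) s)
      ((contDiff_cutoff.continuous_deriv le_rfl).intervalIntegrable _ _),
    cutoff_eq_one (by norm_num), cutoff_eq_zero (by norm_num), sub_zero]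

/-! ### The volume of the gauge ball from the cutoff -/

namespace IsSmoothGauge

variable {d : ℕ} {N : Space d → ℝ} (hN : IsSmoothGauge N)

include hN

/-- By Fubini, the integral of the tails is ∫ r^{-n} χ'(r) vol{N < r} dr; the volume is r^n Vol_N,
the powers cancel, and ∫ χ' = 1. -/
theorem integral_cutoffPrimitive :
    ∫ z, cutoffPrimitive (d + 1) (N z) = -ballVol N := by
  let F : Space d → ℝ → ℝ := fun z r => {p : Space d × ℝ | N p.1 < p.2}.indicator
    (fun p => cutoffWeight (d + 1) p.2) (z, r)
  have hmeas : MeasurableSet {p : Space d × ℝ | N p.1 < p.2} :=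
    (isOpen_lt (hN.continuous.comp continuous_fst) continuous_snd).measurableSet
  have hF : Integrable (Function.uncurry F) (volume.prod volume) := by
    -- The weight vanishes for r > 2, so N z < r forces N z < 3 wherever the integrand is nonzero;
    -- this gives an integrable product as majorant.
    have hg : Integrable (fun p : Space d × ℝ => {z : Space d | N z < 3}.indicator
        (fun _ => (1 : ℝ)) p.1 * |cutoffWeight (d + 1) p.2|) (volume.prod volume) := by
      refine Integrable.mul_prod ?_ (integrable_cutoffWeight (d + 1)).abs
      exact (integrable_indicator_iff
        (isOpen_lt hN.continuous continuous_const).measurableSet).2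
        (integrableOn_const (hN.volume_lt_ne_top 3))
    refine hg.mono' ?_ (ae_of_all _ fun p => ?_)
    · exact (((continuous_cutoffWeight (d + 1)).comp
        continuous_snd).aestronglyMeasurable).indicator hmeas
    · obtain ⟨z, r⟩ := p
      simp only [Function.uncurry, F, indicator_apply, mem_ofPred_eq]
      rcases le_or_gt r 2 with hr | hr
      · split_ifs with h1 h2
        · simp
        · linarith
        · simp
        · simp
      · simp [cutoffWeight_of_gt _ hr]
  have hswap := integral_integral_swap hF
  have h1 : ∀ z, ∫ r, F z r = -cutoffPrimitive (d + 1) (N z) := by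
    intro z
    rw [cutoffPrimitive_eq, neg_neg, ← integral_indicator measurableSet_Ioi]
    rfl
  have h2 : ∀ r, ∫ z, F z r = deriv cutoff r * ballVol N := by
    intro r
    have h3 : (fun z => F z r) = {z : Space d | N z < r}.indicator
        fun _ => cutoffWeight (d + 1) r := rfl
    rw [h3, integral_indicator (isOpen_lt hN.continuous continuous_const).measurableSet,
      setIntegral_const, smul_eq_mul, measureReal_def]
    rcases le_or_gt r 0 with hr | hr
    · rw [cutoffWeight_of_lt _ (by linarith), deriv_cutoff_of_lt (by linarith), mul_zero, zero_mul]
    · rw [hN.volume_lt hr, cutoffWeight]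
      have : r ^ (d + 1) ≠ 0 := by positivity
      field_simp
  simp only [h1, h2, integral_neg, integral_mul_const, integral_deriv_cutoff, one_mul] at hswap
  linarith

theorem hasCompactSupport_cutoffPrimitive :
    HasCompactSupport fun z => cutoffPrimitive (d + 1) (N z) :=
  HasCompactSupport.intro (hN.isCompact_le 2) fun _ hz =>
    cutoffPrimitive_of_ge _ (not_le.1 hz).le

theorem contDiff_cutoffPrimitive_comp :
    ContDiff ℝ 1 fun z => cutoffPrimitive (d + 1) (N z) :=
  hN.contDiff_comp (contDiff_cutoffPrimitive _) fun _ hs => cutoffPrimitive_of_lt _ hs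

theorem continuous_partialDeriv_cutoffPrimitive (j : Fin (d + 1)) :
    Continuous (partialDeriv (fun z => cutoffPrimitive (d + 1) (N z)) j) :=
  (hN.contDiff_cutoffPrimitive_comp.continuous_fderiv (by simp)).clm_apply continuous_const

theorem hasCompactSupport_partialDeriv_cutoffPrimitive (j : Fin (d + 1)) :
    HasCompactSupport (partialDeriv (fun z => cutoffPrimitive (d + 1) (N z)) j) :=
  hN.hasCompactSupport_cutoffPrimitive.fderiv_apply (𝕜 := ℝ) _

/-- Integration by parts moves ∂_j to the coordinate z_i and leaves -δ_ij times the integral of the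
primitive. These moments replace the integrals over the sphere N = 1. -/
theorem integral_partialDeriv_cutoffPrimitive (i j : Fin (d + 1)) :
    ∫ z : Space d, partialDeriv (fun z => cutoffPrimitive (d + 1) (N z)) j z * z i =
      if i = j then ballVol N else 0 := by
  have hc : Continuous fun z : Space d => z i := by fun_prop
  have hfd : ∀ z : Space d, fderiv ℝ (fun z : Space d => z i) z (EuclideanSpace.single j 1) =
      if i = j then 1 else 0 := by
    intro z
    have : HasFDerivAt (fun z : Space d => z i) (EuclideanSpace.proj i : Space d →L[ℝ] ℝ) z :=
      (EuclideanSpace.proj i : Space d →L[ℝ] ℝ).hasFDerivAt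
    rw [this.fderiv]
    simp
  have hcd := hN.contDiff_cutoffPrimitive_comp
  have h := integral_mul_fderiv_eq_neg_fderiv_mul_of_integrable (μ := (volume : Measure (Space d)))
    (f := fun z => cutoffPrimitive (d + 1) (N z)) (g := fun z : Space d => z i)
    (v := EuclideanSpace.single j 1)
    (((hN.continuous_partialDeriv_cutoffPrimitive j).mul hc).integrable_of_hasCompactSupport
      (hN.hasCompactSupport_partialDeriv_cutoffPrimitive j).mul_right)
    (by
      simp only [hfd]
      exact (hcd.continuous.mul continuous_const).integrable_of_hasCompactSupport
        hN.hasCompactSupport_cutoffPrimitive.mul_right)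
    ((hcd.continuous.mul hc).integrable_of_hasCompactSupport
      hN.hasCompactSupport_cutoffPrimitive.mul_right)
    (fun z _ => hcd.differentiable (by simp) z)
    (fun z _ => by fun_prop)
  simp only [hfd, integral_mul_const, hN.integral_cutoffPrimitive] at h
  simp only [partialDeriv]
  rw [← neg_eq_iff_eq_neg.2 h]
  split_ifs <;> simp

theorem contDiff_cutoff_comp : ContDiff ℝ 1 fun z => cutoff (N z) :=
  hN.contDiff_comp contDiff_cutoff fun _ hs => cutoff_eq_zero hs.le

/-- This is what the weight s^{-n} χ' is made for: the singular factor N^{-n} is absorbed into a C¹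
function. At the origin both sides vanish, since the cutoff is constant nearby. -/
theorem partialDeriv_cutoffPrimitive (j : Fin (d + 1)) (z : Space d) :
    partialDeriv (fun z => cutoffPrimitive (d + 1) (N z)) j z =
      (N z ^ (d + 1))⁻¹ * partialDeriv (fun z => cutoff (N z)) j z := by
  rcases eq_or_ne z 0 with rfl | hz
  · have h : N 0 < 1 := by rw [hN.map_zero]; norm_num
    have hev := hN.continuous.continuousAt.eventually (gt_mem_nhds h)
    have h1 : (fun z => cutoff (N z)) =ᶠ[𝓝 0] fun _ => 0 := by
      filter_upwards [hev] with z hz using cutoff_eq_zero hz.le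
    have h2 : (fun z => cutoffPrimitive (d + 1) (N z)) =ᶠ[𝓝 0]
        fun _ => cutoffPrimitive (d + 1) 1 := by
      filter_upwards [hev] with z hz using cutoffPrimitive_of_lt _ hz
    rw [partialDeriv, partialDeriv, h1.fderiv_eq, h2.fderiv_eq]
    simp
  · rw [hN.partialDeriv_comp (contDiff_cutoffPrimitive _) hz,
      hN.partialDeriv_comp contDiff_cutoff hz, (hasDerivAt_cutoffPrimitive _ _).deriv,
      cutoffWeight, mul_assoc]

theorem partialDeriv_cutoff_eq_zero (j : Fin (d + 1)) {z : Space d} (hz : 2 < N z) :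
    partialDeriv (fun z => cutoff (N z)) j z = 0 := by
  have h : (fun z => cutoff (N z)) =ᶠ[𝓝 z] fun _ => 1 := by
    filter_upwards [hN.continuous.continuousAt.eventually (lt_mem_nhds hz)] with z hz
      using cutoff_eq_one hz.le
  rw [partialDeriv, h.fderiv_eq]
  simp

end IsSmoothGauge

theorem IsSmoothGauge.partialDeriv_cutoff_zero {d : ℕ} {N : Space d → ℝ} (hN : IsSmoothGauge N)
    (j : Fin (d + 1)) : partialDeriv (fun z => cutoff (N z)) j 0 = 0 := by
  have h : N 0 < 1 := by rw [hN.map_zero]; norm_num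
  have h1 : (fun z => cutoff (N z)) =ᶠ[𝓝 0] fun _ => 0 := by
    filter_upwards [hN.continuous.continuousAt.eventually (gt_mem_nhds h)] with z hz
      using cutoff_eq_zero hz.le
  rw [partialDeriv, h1.fderiv_eq]
  simp

/-! ### Concentration of the boundary integral at the point x -/

section Blowup

variable {d : ℕ} {D : Set (Space d)} {A : Type*} [NormedAddCommGroup A] [NormedSpace ℝ A]
  {N : Space d → ℝ}

/-- The boundary integral of a field without divergence off `x` as an integral over a small
neighbourhood of `x`. -/
theorem BoundaryAtlas.integral_eq_setIntegral_gauge [CompleteSpace A] (T : BoundaryAtlas D)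
    (hD : IsOpen D) (hb : Bornology.IsBounded D) (hN : IsSmoothGauge N) {x : Space d}
    {g : Fin (d + 1) → Space d → A} (hg : ∀ j, ContDiffOn ℝ 1 (g j) (closure D \ {x}))
    (hdiv : ∀ y ∈ D, y ≠ x → ∑ j, partialDeriv (g j) j y = 0) {ε : ℝ} (hε : 0 < ε)
    (hεD : ∀ z, N z ≤ 2 → x + ε • z ∈ D) :
    T.integral g = ∫ z in {z | N z ≤ 2}, ∑ j, partialDeriv (fun z => cutoff (N z)) j z •
      (ε ^ d • g j (x + ε • z)) := by
  set k : Space d → ℝ := fun z => cutoff (N z) with hk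
  -- The cutoff is 0 near x, which removes the singularity, and 1 off D, which leaves the boundary
  -- integral unchanged.
  set θ : Space d → ℝ := fun y => k (ε⁻¹ • (y - x)) with hθ
  have hkc : ContDiff ℝ 1 k := hN.contDiff_cutoff_comp
  have hθc : ContDiff ℝ 1 θ := hkc.comp (by fun_prop)
  have hinv : ∀ y, x + ε • (ε⁻¹ • (y - x)) = y := fun y => by
    rw [smul_smul, mul_inv_cancel₀ hε.ne', one_smul, add_sub_cancel]
  have hgt : ∀ y ∉ D, 2 < N (ε⁻¹ • (y - x)) := by
    intro y hy
    by_contra! hle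
    exact hy (by simpa only [hinv] using hεD _ hle)
  have hθ1 : ∀ y ∉ D, θ y = 1 := fun y hy => cutoff_eq_one (hgt y hy).le
  have hθ0 : θ =ᶠ[𝓝 x] fun _ => 0 := by
    have hc : Continuous fun y => N (ε⁻¹ • (y - x)) := by
      have := hN.continuous
      fun_prop
    have h : N (ε⁻¹ • (x - x)) < 1 := by simp [hN.map_zero]
    filter_upwards [hc.continuousAt.eventually (gt_mem_nhds h)] with y hy
      using cutoff_eq_zero hy.le
  have hG0 : ∀ j, (fun y => θ y • g j y) =ᶠ[𝓝 x] fun _ => 0 := by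
    intro j
    filter_upwards [hθ0] with y hy
    rw [hy, zero_smul]
  have hG : ∀ j, ContDiffOn ℝ 1 (fun y => θ y • g j y) (closure D) := by
    intro j y hy
    rcases eq_or_ne y x with rfl | hne
    · exact ((contDiffAt_const (c := (0 : A))).congr_of_eventuallyEq (hG0 j)).contDiffWithinAt
    · refine hθc.contDiffAt.contDiffWithinAt.smul ?_
      refine (hg j y ⟨hy, hne⟩).mono_of_mem_nhdsWithin ?_
      exact inter_mem_nhdsWithin _ (isOpen_compl_singleton.mem_nhds hne)
  have h1 : T.integral g = T.integral fun j y => θ y • g j y := by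
    refine Finset.sum_congr rfl fun i _ => integral_congr_ae (ae_of_all _ fun t => ?_)
    by_cases ht : T.χ i ((T.patch i).param t) = 0
    · simp [ht]
    · have hf := (T.patch i).param_mem_frontier hD (T.χ_support i (subset_tsupport _ ht))
      rw [hD.frontier_eq] at hf
      simp only [hθ1 _ hf.2, one_smul]
  set Φ : Space d → A :=
    fun y => ∑ j, (ε⁻¹ * partialDeriv k j (ε⁻¹ • (y - x))) • g j y with hΦ
  -- The field is divergence free off x, so only the derivatives of the cutoff survive.
  have h2 : ∀ y ∈ D, ∑ j, partialDeriv (fun y => θ y • g j y) j y = Φ y := by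
    intro y hy
    rcases eq_or_ne y x with rfl | hne
    · simp only [hΦ, sub_self, smul_zero]
      refine Finset.sum_congr rfl fun j _ => ?_
      rw [partialDeriv, (hG0 j).fderiv_eq, hN.partialDeriv_cutoff_zero]
      simp
    · have hθd : HasFDerivAt θ ((fderiv ℝ k (ε⁻¹ • (y - x))).comp
          (ε⁻¹ • ContinuousLinearMap.id ℝ (Space d))) y :=
        ((hkc.differentiable (by simp) _).hasFDerivAt).comp y
          (((hasFDerivAt_id y).sub_const x).const_smul ε⁻¹)
      have hgd : ∀ j, DifferentiableAt ℝ (g j) y := fun j =>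
        (ContDiffOn.contDiffAt (hg j) (mem_of_superset
          ((hD.sdiff isClosed_singleton).mem_nhds ⟨hy, hne⟩)
          (sdiff_subset_sdiff_left subset_closure))).differentiableAt (by simp)
      have h3 : ∀ j, partialDeriv (fun y => θ y • g j y) j y =
          θ y • partialDeriv (g j) j y +
            (ε⁻¹ * partialDeriv k j (ε⁻¹ • (y - x))) • g j y := by
        intro j
        rw [partialDeriv, (hθd.fun_smul (hgd j).hasFDerivAt).fderiv]
        simp [partialDeriv]
      simp only [h3, Finset.sum_add_distrib, ← Finset.smul_sum, hdiv y hy hne, smul_zero, zero_add,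
        hΦ]
  have h4 : ∫ y in D, Φ y = ∫ y, Φ y := by
    refine setIntegral_eq_integral_of_forall_compl_eq_zero fun y hy => ?_
    refine Finset.sum_eq_zero fun j _ => ?_
    rw [hN.partialDeriv_cutoff_eq_zero j (hgt y hy), mul_zero, zero_smul]
  -- Substitution y = x + εz. The volume gives ε^n and the derivative of the cutoff ε^{-1}, whence
  -- the factor ε^d with d = n - 1.
  have h5 : ∫ y, Φ y = ∫ z, ε ^ (d + 1) • Φ (x + ε • z) := by
    have h6 := Measure.integral_comp_smul_of_nonneg (volume : Measure (Space d))
      (fun z => Φ (x + z)) ε (hR := hε.le)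
    rw [integral_smul, h6, integral_add_left_eq_self Φ x, smul_smul]
    simp only [finrank_euclideanSpace, Fintype.card_fin]
    rw [mul_inv_cancel₀ (by positivity), one_smul]
  rw [h1, T.integral_eq hD hb hG, setIntegral_congr_fun hD.measurableSet h2, h4, h5]
  have h7 : ∀ z, ε ^ (d + 1) • Φ (x + ε • z) =
      ∑ j, partialDeriv k j z • (ε ^ d • g j (x + ε • z)) := by
    intro z
    simp only [hΦ, Finset.smul_sum, add_sub_cancel_left, smul_smul, inv_mul_cancel₀ hε.ne',
      one_smul]
    refine Finset.sum_congr rfl fun j _ => ?_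
    congr 1
    field_simp
    ring
  simp only [h7]
  symm
  refine setIntegral_eq_integral_of_forall_compl_eq_zero fun z hz => ?_
  refine Finset.sum_eq_zero fun j _ => ?_
  rw [hN.partialDeriv_cutoff_eq_zero j (not_le.1 hz), zero_smul]

/-- Since h_i(x) = 0, the rescaled functions converge pointwise to the derivative, and
differentiability at x bounds them by C‖z‖ on K for small ε: dominated convergence. -/
theorem tendsto_setIntegral_blowup (hD : IsOpen D) {x : Space d} (hx : x ∈ D) {ι : Type*}
    [Fintype ι] {K : Set (Space d)} (hK : IsCompact K) {w : ι → Space d → ℝ}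
    (hw : ∀ i, Continuous (w i)) {h : ι → Space d → A} (hc : ∀ i, ContinuousOn (h i) D)
    {h' : ι → Space d →L[ℝ] A} (hd : ∀ i, HasFDerivAt (h i) (h' i) x) (h0 : ∀ i, h i x = 0) :
    Tendsto (fun ε : ℝ => ∫ z in K, ∑ i, w i z • (ε⁻¹ • h i (x + ε • z))) (𝓝[>] 0)
      (𝓝 (∫ z in K, ∑ i, w i z • h' i z)) := by
  obtain ⟨R, hR⟩ := hK.isBounded.exists_norm_le
  have hnear : ∀ p : Space d → Prop, (∀ᶠ y in 𝓝 x, p y) →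
      ∀ᶠ ε : ℝ in 𝓝[>] 0, ∀ z ∈ K, p (x + ε • z) := by
    intro p hp
    obtain ⟨δ, hδ, hball⟩ := Metric.eventually_nhds_iff.1 hp
    have h1 : ∀ᶠ ε : ℝ in 𝓝 0, |ε| * |R| < δ := by
      have hc : Continuous fun ε : ℝ => |ε| * |R| := by fun_prop
      exact hc.continuousAt.eventually (gt_mem_nhds (by simpa using hδ))
    filter_upwards [mem_nhdsWithin_of_mem_nhds h1] with ε hε z hz
    refine hball ?_
    rw [dist_eq_norm, add_sub_cancel_left, norm_smul, Real.norm_eq_abs]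
    exact lt_of_le_of_lt (by gcongr; exact (hR z hz).trans (le_abs_self R)) hε
  have hO : ∀ i, ∃ C, ∀ᶠ y in 𝓝 x, ‖h i y‖ ≤ C * ‖y - x‖ := by
    intro i
    have h1 := (hd i).isBigO_sub
    simp only [h0, sub_zero] at h1
    exact h1.bound
  choose C hC using hO
  refine tendsto_integral_filter_of_dominated_convergence
    (fun z => ∑ i, ‖w i z‖ * (C i * ‖z‖)) ?_ ?_ ?_ ?_
  · filter_upwards [hnear (· ∈ D) (hD.mem_nhds hx)] with ε hε
    refine ContinuousOn.aestronglyMeasurable ?_ hK.measurableSet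
    refine continuousOn_finsetSum _ fun i _ => (hw i).continuousOn.smul (continuousOn_const.smul ?_)
    exact (hc i).comp (by fun_prop) hε
  · have hall : ∀ᶠ ε : ℝ in 𝓝[>] 0, ∀ i, ∀ z ∈ K, ‖h i (x + ε • z)‖ ≤ C i * ‖x + ε • z - x‖ :=
      eventually_all.2 fun i => hnear _ (hC i)
    filter_upwards [hall, self_mem_nhdsWithin] with ε hε hpos
    have hpos : 0 < ε := hpos
    refine (ae_restrict_iff' hK.measurableSet).2 (ae_of_all _ fun z hz => ?_)
    refine (norm_sum_le _ _).trans (Finset.sum_le_sum fun i _ => ?_)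
    rw [norm_smul, norm_smul, norm_inv, Real.norm_of_nonneg hpos.le]
    refine mul_le_mul_of_nonneg_left ?_ (norm_nonneg _)
    have h1 := hε i z hz
    rw [add_sub_cancel_left, norm_smul, Real.norm_of_nonneg hpos.le] at h1
    rw [inv_mul_le_iff₀ hpos]
    linarith
  · refine ContinuousOn.integrableOn_compact hK (Continuous.continuousOn ?_)
    exact continuous_finsetSum _ fun i _ => (hw i).norm.mul (by fun_prop)
  · refine ae_of_all _ fun z => tendsto_finsetSum _ fun i _ => ?_
    have h1 := ((hd i).hasLineDerivAt z).tendsto_slope_zero_right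
    simp only [h0, sub_zero] at h1
    exact h1.const_smul (w i z)

/-- The boundary integral of a field that has no divergence off `x` and is homogeneous of degree
`1 - n` at `x` up to terms of higher order. -/
theorem BoundaryAtlas.integral_eq_smul_sum [CompleteSpace A] (T : BoundaryAtlas D)
    (hD : IsOpen D) (hb : Bornology.IsBounded D) (hN : IsSmoothGauge N) {x : Space d}
    (hx : x ∈ D) {h : Fin (d + 1) → Space d → A} (hh : ∀ j, ContDiffOn ℝ 1 (h j) (closure D))
    (h0 : ∀ j, h j x = 0)
    (hdiv : ∀ y ∈ D, y ≠ x →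
      ∑ j, partialDeriv (fun y => (N (y - x) ^ (d + 1))⁻¹ • h j y) j y = 0) :
    T.integral (fun j y => (N (y - x) ^ (d + 1))⁻¹ • h j y) =
      ballVol N • ∑ j, partialDeriv (h j) j x := by
  have hsub : ∀ y, y ≠ x → y - x ≠ 0 := fun y hy => sub_ne_zero.2 hy
  have hg : ∀ j, ContDiffOn ℝ 1 (fun y => (N (y - x) ^ (d + 1))⁻¹ • h j y) (closure D \ {x}) := by
    intro j y hy
    have hne : y ≠ x := hy.2
    have h1 : ContDiffAt ℝ 1 (fun y => N (y - x)) y :=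
      (hN.contDiffAt (hsub y hne)).comp y (contDiffAt_id.sub contDiffAt_const)
    exact ((h1.pow (d + 1)).inv (pow_ne_zero _ (hN.pos (hsub y hne)).ne')).contDiffWithinAt.smul
      ((hh j).mono sdiff_subset y hy)
  have hK := hN.isCompact_le 2
  have hd : ∀ j, HasFDerivAt (h j) (fderiv ℝ (h j) x) x := fun j =>
    ((contDiffAt_of_mem hD (hh j) hx).differentiableAt (by simp)).hasFDerivAt
  have hlim := tendsto_setIntegral_blowup hD hx hK
    (w := fun j => partialDeriv (fun z => cutoffPrimitive (d + 1) (N z)) j)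
    hN.continuous_partialDeriv_cutoffPrimitive
    (fun j => (hh j).continuousOn.mono subset_closure) hd h0
  -- The boundary integral equals the rescaled integral for every small ε, hence also its limit. The
  -- powers combine as ε^d (ε N(z))^{-(d+1)} = ε^{-1} N(z)^{-(d+1)}.
  have hconst : ∀ᶠ ε : ℝ in 𝓝[>] 0, T.integral (fun j y => (N (y - x) ^ (d + 1))⁻¹ • h j y) =
      ∫ z in {z | N z ≤ 2}, ∑ j, partialDeriv (fun z => cutoffPrimitive (d + 1) (N z)) j z •
        (ε⁻¹ • h j (x + ε • z)) := by
    obtain ⟨δ, hδ, hball⟩ := Metric.isOpen_iff.1 hD x hx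
    obtain ⟨c, hc, hcN⟩ := hN.exists_mul_norm_le
    have hev : ∀ᶠ ε : ℝ in 𝓝 0, |ε| * (2 / c) < δ := by
      have hcont : Continuous fun ε : ℝ => |ε| * (2 / c) := by fun_prop
      exact hcont.continuousAt.eventually (gt_mem_nhds (by simpa using hδ))
    filter_upwards [mem_nhdsWithin_of_mem_nhds hev, self_mem_nhdsWithin] with ε hε hpos
    have hpos : 0 < ε := hpos
    rw [T.integral_eq_setIntegral_gauge hD hb hN hg hdiv hpos]
    · congr 1
      ext z
      refine Finset.sum_congr rfl fun j _ => ?_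
      rw [hN.partialDeriv_cutoffPrimitive, add_sub_cancel_left, hN.homogeneous, abs_of_pos hpos,
        smul_smul, smul_smul, smul_smul]
      congr 1
      rw [mul_pow, mul_inv, pow_succ ε d, mul_inv]
      field_simp
    · intro z hz
      refine hball ?_
      rw [Metric.mem_ball, dist_eq_norm, add_sub_cancel_left, norm_smul, Real.norm_eq_abs]
      refine lt_of_le_of_lt ?_ hε
      gcongr
      rw [le_div_iff₀ hc, mul_comm]
      exact (hcN z).trans hz
  have heq := tendsto_nhds_unique (tendsto_const_nhds.congr' hconst) hlim
  rw [heq]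
  have hexp : ∀ j (z : Space d), fderiv ℝ (h j) x z = ∑ i, z i • partialDeriv (h j) i x := by
    intro j z
    conv_lhs => rw [← (EuclideanSpace.basisFun (Fin (d + 1)) ℝ).sum_repr z]
    simp [partialDeriv]
  have hext : ∫ z in {z | N z ≤ 2}, ∑ j, partialDeriv (fun z => cutoffPrimitive (d + 1) (N z)) j z •
      fderiv ℝ (h j) x z = ∫ z, ∑ j, partialDeriv (fun z => cutoffPrimitive (d + 1) (N z)) j z •
      fderiv ℝ (h j) x z := by
    refine setIntegral_eq_integral_of_forall_compl_eq_zero fun z hz => ?_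
    refine Finset.sum_eq_zero fun j _ => ?_
    rw [hN.partialDeriv_cutoffPrimitive, hN.partialDeriv_cutoff_eq_zero j (not_le.1 hz), mul_zero,
      zero_smul]
  rw [hext]
  simp only [hexp, Finset.smul_sum, smul_smul]
  have hint : ∀ i j : Fin (d + 1), Integrable fun z : Space d =>
      partialDeriv (fun z => cutoffPrimitive (d + 1) (N z)) j z * z i := fun i j =>
    ((hN.continuous_partialDeriv_cutoffPrimitive j).mul (by fun_prop)).integrable_of_hasCompactSupport
      (hN.hasCompactSupport_partialDeriv_cutoffPrimitive j).mul_right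
  rw [integral_finsetSum _ fun j _ => integrable_finsetSum _ fun i _ => (hint i j).smul_const _]
  refine Finset.sum_congr rfl fun j _ => ?_
  rw [integral_finsetSum _ fun i _ => (hint i j).smul_const _]
  simp only [integral_smul_const, hN.integral_partialDeriv_cutoffPrimitive]
  simp

end Blowup

/-! ### From (C2) to the integral representation -/

section Conditions

variable {d q : ℕ} {D : Set (Space d)} {A : Type*} [NormedRing A] [NormedAlgebra ℝ A]
  {a : Fin (d + 1) → Fin q → Space d → A} {φ : Fin q → Space d → Space d → A} {x : Space d}

theorem fderiv_kernel_apply (m : Fin q) (z : Space d) :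
    fderiv ℝ (φ m x) x z = ∑ i, z i • linCoeff φ x i m := by
  conv_lhs => rw [← (EuclideanSpace.basisFun (Fin (d + 1)) ℝ).sum_repr z]
  simp [partialDeriv, linCoeff]

theorem hasFDerivAt_kernel (hD : IsOpen D) (hφ : IsKernelFamily D φ x) (m : Fin q) {y : Space d}
    (hy : y ∈ D) : HasFDerivAt (φ m x) (fderiv ℝ (φ m x) y) y :=
  ((contDiffAt_of_mem hD (hφ m).1 hy).differentiableAt (by simp)).hasFDerivAt

/-- (C2) implies the integral representation. -/
theorem hasIntegralRepresentation_of_condC2 [FiniteDimensional ℝ A]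
    (hD : IsSmoothBoundedDomain D) (ha : ∀ j m, ContDiffOn ℝ 1 (a j m) (closure D))
    {f : Space d → A} (hf : ContDiffOn ℝ 1 f (closure D)) (hcf : CauchyConditions D a f)
    {N : Space d → ℝ} (hN : IsSmoothGauge N) (hx : x ∈ D) (hφ : IsKernelFamily D φ x)
    (hC2 : CondC2 N D a φ x) : HasIntegralRepresentation N D a φ f x := by
  have : CompleteSpace A := FiniteDimensional.complete ℝ A
  refine ⟨hD.nonempty_boundaryAtlas, fun T => ?_⟩
  set h : Fin (d + 1) → Space d → A := fun j y => f y * ∑ m, a j m y * φ m x y with hh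
  have hhc : ∀ j, ContDiffOn ℝ 1 (h j) (closure D) := fun j =>
    hf.mul (ContDiffOn.sum fun m _ => (ha j m).mul (hφ m).1)
  have hh0 : ∀ j, h j x = 0 := fun j => by simp [hh, (hφ _).2]
  have hfun : (fun j y => f y * ∑ m, a j m y * ((N (y - x) ^ (d + 1))⁻¹ • φ m x y)) =
      fun j y => (N (y - x) ^ (d + 1))⁻¹ • h j y := by
    ext j y
    simp only [hh, mul_smul_comm, ← Finset.smul_sum]
  have hfd : ∀ y ∈ D, HasFDerivAt f (fderiv ℝ f y) y := fun y hy =>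
    ((contDiffAt_of_mem hD.isOpen hf hy).differentiableAt (by simp)).hasFDerivAt
  have had : ∀ j m, ∀ y ∈ D, HasFDerivAt (a j m) (fderiv ℝ (a j m) y) y := fun j m y hy =>
    ((contDiffAt_of_mem hD.isOpen (ha j m) hy).differentiableAt (by simp)).hasFDerivAt
  -- The product rule is applied to (f a^j_m) φ_m with f a^j_m kept together, since the hypothesis
  -- on f concerns these products; the order of the factors matters in A.
  have hhd : ∀ j, ∀ y ∈ D, partialDeriv (h j) j y =
      ∑ m, (partialDeriv (fun z => f z * a j m z) j y * φ m x y +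
        f y * (a j m y * partialDeriv (φ m x) j y)) := by
    intro j y hy
    have e1 : h j = fun y => ∑ m, (f y * a j m y) * φ m x y := by
      ext y
      simp only [hh, Finset.mul_sum, mul_assoc]
    have e2 : ∀ m, HasFDerivAt (fun z => f z * a j m z) (fderiv ℝ (fun z => f z * a j m z) y) y :=
      fun m => ((hfd y hy).mul' (had j m y hy)).differentiableAt.hasFDerivAt
    have e3 : HasFDerivAt (fun y => ∑ m, f y * a j m y * φ m x y) _ y := HasFDerivAt.fun_sum
      fun m _ => (e2 m).mul' (hasFDerivAt_kernel hD.isOpen hφ m hy)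
    rw [e1, partialDeriv, e3.fderiv]
    simp only [partialDeriv, _root_.sum_apply, _root_.add_apply, _root_.smul_apply, smul_eq_mul,
      MulOpposite.smul_eq_mul_unop, MulOpposite.unop_op]
    refine Finset.sum_congr rfl fun m _ => ?_
    rw [add_comm, mul_assoc]
  rw [hfun, T.integral_eq_smul_sum hD.isOpen hD.isBounded hN hx hhc hh0]
  · simp only [hhd _ x hx, (hφ _).2, mul_zero, zero_add, ← Finset.mul_sum]
    rw [Finset.sum_comm, hC2.1, mul_smul_comm, mul_one, smul_smul,
      mul_inv_cancel₀ hN.ballVol_pos.ne', one_smul]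
  · intro y hy hne
    have hne' : y - x ≠ 0 := sub_ne_zero.2 hne
    have hpos : N (y - x) ^ (d + 1) ≠ 0 := pow_ne_zero _ (hN.pos hne').ne'
    have hNd : HasFDerivAt (fun z => N (z - x) ^ (d + 1))
        (fderiv ℝ (fun z => N (z - x) ^ (d + 1)) y) y := by
      have h1 : ContDiffAt ℝ 1 (fun z => N (z - x)) y :=
        (hN.contDiffAt hne').comp y (contDiffAt_id.sub contDiffAt_const)
      exact ((h1.pow (d + 1)).differentiableAt (by simp)).hasFDerivAt
    have hlog : ∀ j, partialDeriv (fun z => Real.log (N (z - x) ^ (d + 1))) j y =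
        (N (y - x) ^ (d + 1))⁻¹ * partialDeriv (fun z => N (z - x) ^ (d + 1)) j y := by
      intro j
      rw [partialDeriv, (hNd.log hpos).fderiv]
      rfl
    have hterm : ∀ j, partialDeriv (fun y => (N (y - x) ^ (d + 1))⁻¹ • h j y) j y =
        (N (y - x) ^ (d + 1))⁻¹ • (partialDeriv (h j) j y -
          partialDeriv (fun z => Real.log (N (z - x) ^ (d + 1))) j y • h j y) := by
      intro j
      have h1 : HasFDerivAt (h j) (fderiv ℝ (h j) y) y :=
        ((contDiffAt_of_mem hD.isOpen (hhc j) hy).differentiableAt (by simp)).hasFDerivAt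
      have h2 : HasFDerivAt (fun z => (N (z - x) ^ (d + 1))⁻¹) _ y :=
        (hasDerivAt_inv hpos).comp_hasFDerivAt y hNd
      rw [hlog, partialDeriv, (h2.fun_smul h1).fderiv]
      simp only [partialDeriv, _root_.add_apply, _root_.smul_apply,
        ContinuousLinearMap.smulRight_apply, smul_eq_mul]
      rw [smul_sub, smul_smul, sub_eq_add_neg _ (_ • h j y), ← neg_smul]
      congr 2
      field_simp
    have e1 : ∀ j, ∑ m, (partialDeriv (fun z => f z * a j m z) j y * φ m x y +
        f y * (a j m y * partialDeriv (φ m x) j y)) -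
        partialDeriv (fun z => Real.log (N (z - x) ^ (d + 1))) j y • h j y =
        (∑ m, partialDeriv (fun z => f z * a j m z) j y * φ m x y) +
        f y * ∑ m, a j m y * (partialDeriv (φ m x) j y -
          partialDeriv (fun z => Real.log (N (z - x) ^ (d + 1))) j y • φ m x y) := by
      intro j
      simp only [hh, Finset.sum_add_distrib, mul_sub, Finset.sum_sub_distrib, Finset.mul_sum,
        mul_smul_comm, Finset.smul_sum]
      abel
    -- The factor N^{-n} comes out of the divergence. What remains is the terms with ∂_j(f a^j_m),
    -- zero by the Cauchy conditions, and f times the second expression of (C2).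
    simp only [hterm, ← Finset.smul_sum, hhd _ y hy, e1]
    simp only [Finset.sum_add_distrib, ← Finset.mul_sum]
    have e2 : ∑ j, ∑ m, partialDeriv (fun z => f z * a j m z) j y * φ m x y = 0 := by
      rw [Finset.sum_comm]
      refine Finset.sum_eq_zero fun m _ => ?_
      rw [← Finset.sum_mul, hcf m y hy, zero_mul]
    rw [e2, Finset.sum_comm, hC2.2 y hy hne, mul_zero, add_zero, smul_zero]

/-! ### The Euclidean case -/

theorem partialDeriv_norm_sq (x y : Space d) (j : Fin (d + 1)) :
    partialDeriv (fun z => ‖z - x‖ ^ 2) j y = 2 * (y j - x j) := by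
  have h : HasFDerivAt (fun z : Space d => ‖z - x‖ ^ 2) _ y :=
    ((hasFDerivAt_id y).sub_const x).norm_sq
  rw [partialDeriv, h.fderiv]
  simp [EuclideanSpace.inner_single_right]

theorem partialDeriv_log_norm {x y : Space d} (hy : y ≠ x) (j : Fin (d + 1)) :
    partialDeriv (fun z => Real.log (euclideanNorm d (z - x) ^ (d + 1))) j y =
      (d + 1 : ℝ) / (2 * ‖y - x‖ ^ 2) * partialDeriv (fun z => ‖z - x‖ ^ 2) j y := by
  have h0 : ‖y - x‖ ^ 2 ≠ 0 := pow_ne_zero _ (norm_ne_zero_iff.2 (sub_ne_zero.2 hy))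
  have h1 : DifferentiableAt ℝ (fun z : Space d => ‖z - x‖ ^ 2) y :=
    ((hasFDerivAt_id y).sub_const x).norm_sq.differentiableAt
  have h2 : (fun z => Real.log (euclideanNorm d (z - x) ^ (d + 1))) =
      fun z => (d + 1 : ℝ) / 2 * Real.log (‖z - x‖ ^ 2) := by
    ext z
    rw [Real.log_pow, Real.log_pow, euclideanNorm]
    push_cast
    ring
  rw [h2, partialDeriv, ((h1.hasFDerivAt.log h0).const_mul _).fderiv]
  simp only [partialDeriv, _root_.smul_apply, smul_eq_mul]
  field_simp

/-- The logarithmic derivative of `‖y - x‖ⁿ`. -/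
noncomputable def logDer (x y : Space d) (j : Fin (d + 1)) : ℝ :=
  (d + 1 : ℝ) / (2 * ‖y - x‖ ^ 2) * partialDeriv (fun z => ‖z - x‖ ^ 2) j y

theorem logDer_eq (x y : Space d) (j : Fin (d + 1)) :
    logDer x y j = (d + 1 : ℝ) / ‖y - x‖ ^ 2 * (y j - x j) := by
  rw [logDer, partialDeriv_norm_sq, div_mul_eq_mul_div, div_mul_eq_mul_div]
  rw [show (d + 1 : ℝ) * (2 * (y j - x j)) = 2 * ((d + 1) * (y j - x j)) by ring,
    mul_div_mul_left _ _ two_ne_zero]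

/-- The products `∑_m a^j_m b^i_m`. -/
def pairing (α b : Matrix (Fin (d + 1)) (Fin q) A) (j i : Fin (d + 1)) : A :=
  ∑ m, α j m * b i m

/-- The first order part of the left hand side of the second condition in (C2). -/
theorem sum_linear_terms (α : Matrix (Fin (d + 1)) (Fin q) A) (y : Space d) :
    ∑ m, ∑ j, α j m * (linCoeff φ x j m - logDer x y j • linPart φ m x y) =
      ∑ j, pairing α (linCoeff φ x) j j - ((d + 1 : ℝ) / ‖y - x‖ ^ 2) •
        ∑ j, ∑ i, ((y j - x j) * (y i - x i)) • pairing α (linCoeff φ x) j i := by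
  rw [Finset.sum_comm]
  simp only [mul_sub, Finset.sum_sub_distrib, pairing, linPart, logDer_eq, Finset.smul_sum,
    Finset.mul_sum, mul_smul_comm, smul_smul]
  congr 1
  refine Finset.sum_congr rfl fun j _ => ?_
  rw [Finset.sum_comm]
  refine Finset.sum_congr rfl fun i _ => Finset.sum_congr rfl fun m _ => ?_
  congr 1
  ring

theorem sum_pairing_of_condC5 {α b : Matrix (Fin (d + 1)) (Fin q) A} (h : CondC5 α b) :
    ∑ j, pairing α b j j =
      (d + 1 : ℝ) • ((d + 1 : ℝ) * ballVol (euclideanNorm d))⁻¹ • (1 : A) := by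
  have hd : ∀ j, pairing α b j j = ((d + 1 : ℝ) * ballVol (euclideanNorm d))⁻¹ • (1 : A) := h.1
  simp only [hd, Finset.sum_const, Finset.card_univ, Fintype.card_fin]
  rw [← Nat.cast_smul_eq_nsmul ℝ]
  push_cast
  rfl

theorem sum_quadratic_of_condC5 {α b : Matrix (Fin (d + 1)) (Fin q) A} (h : CondC5 α b)
    (z : Fin (d + 1) → ℝ) :
    ∑ j, ∑ i, (z j * z i) • pairing α b j i =
      (∑ j, z j ^ 2) • ((d + 1 : ℝ) * ballVol (euclideanNorm d))⁻¹ • (1 : A) := by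
  set c := ((d + 1 : ℝ) * ballVol (euclideanNorm d))⁻¹ • (1 : A) with hc
  have hd : ∀ j, pairing α b j j = c := h.1
  have ho : ∀ i j, i ≠ j → pairing α b j i + pairing α b i j = 0 := fun i j hij => by
    have := h.2 i j hij
    rwa [Finset.sum_add_distrib] at this
  -- The double sum is added to its transpose, so that the off-diagonal terms cancel in pairs.
  have h2 : (2 : ℝ) • ∑ j, ∑ i, (z j * z i) • pairing α b j i = (2 : ℝ) • (∑ j, z j ^ 2) • c := by
    have h3 : ∑ j, ∑ i, (z j * z i) • pairing α b j i = ∑ j, ∑ i, (z j * z i) • pairing α b i j := by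
      rw [Finset.sum_comm]
      simp only [mul_comm]
    rw [two_smul]
    conv_lhs => rw [h3]
    conv_lhs => enter [2]; rw [← h3]
    rw [← Finset.sum_add_distrib, Finset.sum_smul, Finset.smul_sum]
    refine Finset.sum_congr rfl fun j _ => ?_
    rw [← Finset.sum_add_distrib, Finset.sum_eq_single j]
    · rw [hd, two_smul, sq]
    · intro i _ hij
      rw [← smul_add, ho j i hij.symm, smul_zero]
    · simp
  exact smul_right_injective A (two_ne_zero (α := ℝ)) h2

/-- Polarization: the unit vectors give the diagonal conditions, sums of two of them the others. -/
theorem condC5_of_quadratic {α b : Matrix (Fin (d + 1)) (Fin q) A} {c : A}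
    (hc : c = ((d + 1 : ℝ) * ballVol (euclideanNorm d))⁻¹ • (1 : A))
    (h : ∀ z : Fin (d + 1) → ℝ, ∑ j, ∑ i, (z j * z i) • pairing α b j i = (∑ j, z j ^ 2) • c) :
    CondC5 α b := by
  have hd : ∀ j, pairing α b j j = c := by
    intro j
    have := h (Pi.single j 1)
    simpa [Pi.single_apply, ite_smul, mul_ite, ite_pow] using this
  refine ⟨fun j => (hd j).trans hc, fun i j hij => ?_⟩
  rw [Finset.sum_add_distrib]
  have h1 := h (Pi.single i 1 + Pi.single j 1)
  have h2 : ∀ z w : Fin (d + 1) → ℝ, ∑ j, ∑ i, ((z + w) j * (z + w) i) • pairing α b j i =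
      (∑ j, ∑ i, (z j * z i) • pairing α b j i) + (∑ j, ∑ i, (w j * w i) • pairing α b j i) +
      ((∑ j, ∑ i, (z j * w i) • pairing α b j i) + ∑ j, ∑ i, (w j * z i) • pairing α b j i) := by
    intro z w
    simp only [← Finset.sum_add_distrib, ← add_smul, Pi.add_apply]
    refine Finset.sum_congr rfl fun j _ => Finset.sum_congr rfl fun i _ => ?_
    congr 1
    ring
  have h3 : ∑ l, (Pi.single i 1 + Pi.single j 1 : Fin (d + 1) → ℝ) l ^ 2 =
      ∑ l, (Pi.single i 1 : Fin (d + 1) → ℝ) l ^ 2 + ∑ l, (Pi.single j 1 : Fin (d + 1) → ℝ) l ^ 2 := by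
    rw [← Finset.sum_add_distrib]
    refine Finset.sum_congr rfl fun l _ => ?_
    simp only [Pi.add_apply, Pi.single_apply]
    split_ifs with h4 h5
    · exact absurd (h4.symm.trans h5) hij
    all_goals norm_num
  rw [h2, h, h, h3, add_smul] at h1
  have h5 := add_eq_left.1 h1
  have h6 : ∀ k l : Fin (d + 1), ∑ j, ∑ i, ((Pi.single k 1 : Fin (d + 1) → ℝ) j *
      (Pi.single l 1 : Fin (d + 1) → ℝ) i) • pairing α b j i = pairing α b k l := by
    intro k l
    simp [Pi.single_apply, ite_smul, mul_ite]
  rw [h6, h6, add_comm] at h5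
  exact h5

/-- The second condition of (C2) minus the remainder equation. -/
theorem sum_condC2_sub_remainder (hD : IsOpen D) (hφ : IsKernelFamily D φ x) {y : Space d}
    (hy : y ∈ D) :
    ∑ m, ∑ j, a j m y * (partialDeriv (φ m x) j y - logDer x y j • φ m x y) =
      (∑ m, ∑ j, a j m y * (partialDeriv (remPart φ m x) j y - logDer x y j • remPart φ m x y)) +
      (∑ m, ∑ j, (a j m y - a j m x) * (linCoeff φ x j m - logDer x y j • linPart φ m x y)) +
      ∑ m, ∑ j, a j m x * (linCoeff φ x j m - logDer x y j • linPart φ m x y) := by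
  simp only [← Finset.sum_add_distrib]
  refine Finset.sum_congr rfl fun m _ => Finset.sum_congr rfl fun j _ => ?_
  have h1 : HasFDerivAt (linPart φ m x) (fderiv ℝ (φ m x) x) y := by
    have h2 : linPart φ m x = fun y => fderiv ℝ (φ m x) x (y - x) := by
      ext y
      simp [fderiv_kernel_apply, linPart]
    rw [h2]
    exact ((fderiv ℝ (φ m x) x).hasFDerivAt).comp y ((hasFDerivAt_id y).sub_const x)
  have h3 : partialDeriv (remPart φ m x) j y = partialDeriv (φ m x) j y - linCoeff φ x j m := by
    have h4 : HasFDerivAt (remPart φ m x) _ y := (hasFDerivAt_kernel hD hφ m hy).sub h1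
    rw [partialDeriv, h4.fderiv]
    rfl
  rw [h3, remPart, smul_sub]
  simp only [mul_sub, sub_mul, smul_sub, mul_smul_comm]
  abel

/-- Passing to the limit `y → x` in the second condition of (C2). -/
theorem sum_linear_terms_eq_zero_of_condC2 (hD : IsOpen D)
    (ha : ∀ j m, ContDiffOn ℝ 1 (a j m) (closure D)) (hx : x ∈ D) (hφ : IsKernelFamily D φ x)
    (hC2 : CondC2 (euclideanNorm d) D a φ x) {z : Space d} (hz : z ≠ 0) :
    ∑ m, ∑ j, a j m x * (linCoeff φ x j m - logDer x (x + z) j • linPart φ m x (x + z)) = 0 := by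
  have hpath : Tendsto (fun ε : ℝ => x + ε • z) (𝓝[>] 0) (𝓝 x) := by
    have h1 : Continuous fun ε : ℝ => x + ε • z := by fun_prop
    have h2 := h1.tendsto 0
    simp only [zero_smul, add_zero] at h2
    exact h2.mono_left nhdsWithin_le_nhds
  -- The logarithmic derivative is homogeneous of degree -1 in y - x, so along the ray its factor
  -- ε^{-1} can be shifted to φ, where it forms a difference quotient.
  have hlim : Tendsto (fun ε : ℝ => ∑ m, ∑ j, a j m (x + ε • z) *
      (partialDeriv (φ m x) j (x + ε • z) -
        logDer x (x + z) j • (ε⁻¹ • φ m x (x + ε • z)))) (𝓝[>] 0)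
      (𝓝 (∑ m, ∑ j, a j m x * (linCoeff φ x j m -
        logDer x (x + z) j • linPart φ m x (x + z)))) := by
    refine tendsto_finsetSum _ fun m _ => tendsto_finsetSum _ fun j _ => ?_
    refine Tendsto.mul ?_ (Tendsto.sub ?_ (Tendsto.const_smul ?_ _))
    · exact (contDiffAt_of_mem hD (ha j m) hx).continuousAt.tendsto.comp hpath
    · exact ((continuousOn_partialDeriv hD (hφ m).1 j).continuousAt
        (hD.mem_nhds hx)).tendsto.comp hpath
    · have h1 := ((hasFDerivAt_kernel hD hφ m hx).hasLineDerivAt z).tendsto_slope_zero_right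
      simp only [(hφ m).2, sub_zero, fderiv_kernel_apply] at h1
      simpa [linPart] using h1
  refine tendsto_nhds_unique hlim (tendsto_const_nhds.congr' ?_)
  filter_upwards [hpath.eventually (hD.mem_nhds hx), self_mem_nhdsWithin] with ε hε hpos
  have hpos : 0 < ε := hpos
  have hne : x + ε • z ≠ x := by
    simp [hz, hpos.ne']
  rw [← hC2.2 _ hε hne]
  refine Finset.sum_congr rfl fun m _ => Finset.sum_congr rfl fun j _ => ?_
  rw [partialDeriv_log_norm hne, ← logDer, smul_smul]
  congr 3
  rw [logDer_eq, logDer_eq]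
  simp only [add_sub_cancel_left, norm_smul, Real.norm_eq_abs, mul_pow, sq_abs, PiLp.add_apply,
    PiLp.smul_apply, smul_eq_mul]
  have hz' : ‖z‖ ≠ 0 := norm_ne_zero_iff.2 hz
  field_simp

/-- (C2) splits into its first order part at x and the rest. The first order part is equivalent to
(C5); once it vanishes, the second equation of (C2) and the remainder equation coincide. -/
theorem condC2_iff (hD : IsOpen D) (ha : ∀ j m, ContDiffOn ℝ 1 (a j m) (closure D)) (hx : x ∈ D)
    (hφ : IsKernelFamily D φ x) :
    CondC2 (euclideanNorm d) D a φ x ↔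
      CondC5 (fun j m => a j m x) (linCoeff φ x) ∧ RemainderEquation D a φ x := by
  set c := ((d + 1 : ℝ) * ballVol (euclideanNorm d))⁻¹ • (1 : A) with hc
  have hn : (d + 1 : ℝ) ≠ 0 := by positivity
  have hcV : (d + 1 : ℝ) • c = (ballVol (euclideanNorm d))⁻¹ • (1 : A) := by
    rw [hc, smul_smul, mul_inv, ← mul_assoc, mul_inv_cancel₀ hn, one_mul]
  have hsq : ∀ z : Space d, ‖z‖ ^ 2 = ∑ j, z j ^ 2 := fun z => by
    rw [EuclideanSpace.norm_sq_eq]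
    simp
  have htrace : ∑ m, ∑ j, a j m x * partialDeriv (φ m x) j x =
      ∑ j, pairing (fun j m => a j m x) (linCoeff φ x) j j := by
    rw [Finset.sum_comm]
    rfl
  have hlin : CondC5 (fun j m => a j m x) (linCoeff φ x) → ∀ y, y ≠ x →
      ∑ m, ∑ j, a j m x * (linCoeff φ x j m - logDer x y j • linPart φ m x y) = 0 := by
    intro h5 y hne
    have h0 : ‖y - x‖ ^ 2 ≠ 0 := pow_ne_zero _ (norm_ne_zero_iff.2 (sub_ne_zero.2 hne))
    rw [sum_linear_terms (fun j m => a j m x)]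
    have h1 := sum_quadratic_of_condC5 h5 (fun j => y j - x j)
    rw [h1, smul_smul]
    have h2 : ∑ j, (y j - x j) ^ 2 = ‖y - x‖ ^ 2 := (hsq (y - x)).symm
    rw [h2, div_mul_cancel₀ _ h0, sum_pairing_of_condC5 h5, sub_self]
  have hR : ∀ y ∈ D, y ≠ x →
      ∑ m, ∑ j, a j m x * (linCoeff φ x j m - logDer x y j • linPart φ m x y) = 0 →
      (∑ m, ∑ j, a j m y * (partialDeriv (φ m x) j y -
        partialDeriv (fun z => Real.log (euclideanNorm d (z - x) ^ (d + 1))) j y • φ m x y) = 0 ↔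
      ∑ m, ∑ j, a j m y * (partialDeriv (remPart φ m x) j y - logDer x y j • remPart φ m x y) =
      -∑ m, ∑ j, (a j m y - a j m x) * (linCoeff φ x j m - logDer x y j • linPart φ m x y)) := by
    intro y hy hne h0
    simp only [partialDeriv_log_norm hne]
    have h1 := sum_condC2_sub_remainder (a := a) hD hφ hy
    rw [h0, add_zero] at h1
    rw [← add_eq_zero_iff_eq_neg, ← h1]
    rfl
  constructor
  · intro h
    have h5 : CondC5 (fun j m => a j m x) (linCoeff φ x) := by
      refine condC5_of_quadratic hc fun z => ?_
      rcases eq_or_ne (WithLp.toLp 2 z : Space d) 0 with hz | hz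
      · have hz0 : ∀ j, z j = 0 := fun j => congrFun (congrArg WithLp.ofLp hz) j
        simp [hz0]
      · have h1 := sum_linear_terms_eq_zero_of_condC2 hD ha hx hφ h hz
        -- The trace is n c by the first part of (C2), so the limit relation reads n c = n ‖z‖^{-2}
        -- times the quadratic form at z; multiplying by ‖z‖²/n isolates the form.
        rw [sum_linear_terms (fun j m => a j m x), ← htrace, h.1, ← hcV, add_sub_cancel_left,
          hsq, sub_eq_zero] at h1
        have h0 : ∑ j, z j ^ 2 ≠ 0 := by
          have h2 := hsq (WithLp.toLp 2 z)
          simp only at h2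
          rw [← h2]
          exact pow_ne_zero _ (norm_ne_zero_iff.2 hz)
        have h3 : ∀ j, (x + WithLp.toLp 2 z : Space d) j - x j = z j := fun j => by simp
        simp only [h3] at h1
        have h4 := congrArg (fun w => ((∑ j, z j ^ 2) / (d + 1 : ℝ)) • w) h1
        simp only [smul_smul] at h4
        rw [div_mul_cancel₀ _ hn, div_mul_div_cancel₀ hn, div_self h0, one_smul] at h4
        exact h4.symm
    exact ⟨h5, fun y hy hne => (hR y hy hne (hlin h5 y hne)).1 (h.2 y hy hne)⟩
  · rintro ⟨h5, hrem⟩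
    refine ⟨?_, fun y hy hne => (hR y hy hne (hlin h5 y hne)).2 (hrem y hy hne)⟩
    rw [htrace, ← hcV, sum_pairing_of_condC5 h5]

end Conditions

end CauchyAlgebra

/-! ### The theorem, assembled from its analytic and algebraic halves -/

theorem mainTheorem8 {d : ℕ} {D : Set (CauchyAlgebra.Space d)}
    (hD : CauchyAlgebra.IsSmoothBoundedDomain D) :
    -- arbitrary algebra: the integral representation
    (∀ (A : Type*) [NormedRing A] [NormedAlgebra ℝ A] [FiniteDimensional ℝ A] (q : ℕ)
      (a : Fin (d + 1) → Fin q → CauchyAlgebra.Space d → A),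
      (∀ j m, ContDiffOn ℝ 1 (a j m) (closure D)) →
      -- under (C2), for any gauge
      (∀ f : CauchyAlgebra.Space d → A, ContDiffOn ℝ 1 f (closure D) →
        CauchyAlgebra.CauchyConditions D a f →
        ∀ N : CauchyAlgebra.Space d → ℝ, CauchyAlgebra.IsSmoothGauge N →
        ∀ φ : Fin q → CauchyAlgebra.Space d → CauchyAlgebra.Space d → A, ∀ x ∈ D,
          CauchyAlgebra.IsKernelFamily D φ x →
          CauchyAlgebra.CondC2 N D a φ x →
          CauchyAlgebra.HasIntegralRepresentation N D a φ f x) ∧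
      -- in the Euclidean case (C2) amounts to (C5) and the remainder equation
      (∀ φ : Fin q → CauchyAlgebra.Space d → CauchyAlgebra.Space d → A, ∀ x ∈ D,
        CauchyAlgebra.IsKernelFamily D φ x →
        (CauchyAlgebra.CondC2 (CauchyAlgebra.euclideanNorm d) D a φ x ↔
          CauchyAlgebra.CondC5 (fun j m => a j m x) (CauchyAlgebra.linCoeff φ x) ∧
          CauchyAlgebra.RemainderEquation D a φ x)) ∧
      -- in the Euclidean case, under (C5) and the remainder equation
      (∀ f : CauchyAlgebra.Space d → A, ContDiffOn ℝ 1 f (closure D) →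
        CauchyAlgebra.CauchyConditions D a f →
        ∀ φ : Fin q → CauchyAlgebra.Space d → CauchyAlgebra.Space d → A, ∀ x ∈ D,
          CauchyAlgebra.IsKernelFamily D φ x →
          CauchyAlgebra.CondC5 (fun j m => a j m x) (CauchyAlgebra.linCoeff φ x) →
          CauchyAlgebra.RemainderEquation D a φ x →
          CauchyAlgebra.HasIntegralRepresentation
            (CauchyAlgebra.euclideanNorm d) D a φ f x)) ∧
    -- commutative algebra, Euclidean norm: the conditions (A) and the solutions
    (∀ (A : Type*) [NormedCommRing A] [NormedAlgebra ℝ A] [FiniteDimensional ℝ A] (r t : ℕ)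
      (e : Fin (r + 1) ⊕ Fin t ≃ Fin (d + 1))
      (a : Fin (d + 1) → Fin (r + 1) → CauchyAlgebra.Space d → A),
      (∀ j m, ContDiffOn ℝ 1 (a j m) (closure D)) →
      ∀ x ∈ D, IsUnit (CauchyAlgebra.D0 e (fun j m => a j m x)) →
        -- the first order part of a kernel family with (C2)
        (∀ φ : Fin (r + 1) → CauchyAlgebra.Space d → CauchyAlgebra.Space d → A,
          CauchyAlgebra.IsKernelFamily D φ x →
          CauchyAlgebra.CondC2 (CauchyAlgebra.euclideanNorm d) D a φ x →
          CauchyAlgebra.CondA e (fun j m => a j m x) ∧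
          ∃ γ, CauchyAlgebra.IsAdmissible d γ ∧
            CauchyAlgebra.IsDeterminantSolution e (fun j m => a j m x) γ
              (CauchyAlgebra.linCoeff φ x)) ∧
        -- any solution of (C5)
        (∀ b, CauchyAlgebra.CondC5 (fun j m => a j m x) b →
          CauchyAlgebra.CondA e (fun j m => a j m x) ∧
          ∃ γ, CauchyAlgebra.IsAdmissible d γ ∧
            CauchyAlgebra.IsDeterminantSolution e (fun j m => a j m x) γ b) ∧
        -- conversely, under (A) the formulas define a solution of (C5) for every choice of γ
        (CauchyAlgebra.CondA e (fun j m => a j m x) →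
          ∀ γ, CauchyAlgebra.IsAdmissible d γ →
            ∃ b, CauchyAlgebra.IsDeterminantSolution e (fun j m => a j m x) γ b ∧
              CauchyAlgebra.CondC5 (fun j m => a j m x) b)) := by
  have hV := (CauchyAlgebra.isSmoothGauge_euclideanNorm d).ballVol_pos.ne'
  refine ⟨fun A _ _ _ q a ha => ⟨?_, ?_, ?_⟩, fun A _ _ _ r t e a ha x hx hu => ⟨?_, ?_, ?_⟩⟩
  · intro f hf hcf N hN φ x hx hφ hC2
    exact CauchyAlgebra.hasIntegralRepresentation_of_condC2 hD ha hf hcf hN hx hφ hC2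
  · intro φ x hx hφ
    exact CauchyAlgebra.condC2_iff hD.isOpen ha hx hφ
  · intro f hf hcf φ x hx hφ h5 hR
    exact CauchyAlgebra.hasIntegralRepresentation_of_condC2 hD ha hf hcf
      (CauchyAlgebra.isSmoothGauge_euclideanNorm d) hx hφ
      ((CauchyAlgebra.condC2_iff hD.isOpen ha hx hφ).2 ⟨h5, hR⟩)
  · intro φ hφ hC2
    exact CauchyAlgebra.exists_admissible_of_condC5 e _ _ hV hu
      ((CauchyAlgebra.condC2_iff hD.isOpen ha hx hφ).1 hC2).1
  · intro b hb
    exact CauchyAlgebra.exists_admissible_of_condC5 e _ _ hV hu hb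
  · intro hA γ hγ
    exact CauchyAlgebra.exists_solution_of_condA e _ hu hA γ hγ
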